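/- **Theorem 4.1 (reduction of polysymplectic manifolds).** All manifolds are smooth, finite-dimensional, Hausdorff and without boundary. For a manifold $N$ let $(T^1_k)^*N=T^*N\oplus\cdots\oplus T^*N$ ($k$ summands); for $\bar\alpha=(\alpha_1,\dots,\alpha_k)\in (T^1_k)^*_xN$ and $v\in T_xN$ write $\bar\alpha(v)=(\alpha_1(v),\dots,\alpha_k(v))\in\mathbb R^k$, and let Lie derivatives and $\mathrm d$ act componentwise. For a subspace $W\subseteq T_xN$ put $W^{\circ k}=\{\bar\alpha\in (T^1_k)^*_xN : \bar\alpha|_W=0\}$. A *$k$-polysymplectic structure* on $M$ is a $k$-tuple $\bar\omega=(\omega_1,\dots,\omega_k)$ of closed $2$-forms with $\bigcap_i\ker\omega_i=0$. Let $\bar\omega^\flat\colon TM\to (T^1_k)^*M$, $\bar\omega^\flat(X)=(\omega_1(X,\cdot),\dots,\omega_k(X,\cdot))$, and $S=\operatorname{Im}\bar\omega^\flat$; for $W\subseteq T_pM$ put $W^\perp=\{X\in T_pM:\omega_i(X,w)=0 \text{ for all } w\in W \text{ and all } i\}$. A *$k$-poly-Poisson structure* on $N$ is a pair $(S,\bar\Lambda^\sharp)$,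 where $S$ is a vector subbundle of $(T^1_k)^*N$ and $\bar\Lambda^\sharp\colon S\to TN$ is a vector bundle morphism, such that (1) $\bar\alpha(\bar\Lambda^\sharp(\bar\alpha))=0$ for $\bar\alpha\in S$; (2) if $\bar\alpha\in S_x$ and $\bar\alpha(\bar\Lambda^\sharp(\bar\beta))=0$ for every $\bar\beta\in S_x$, then $\bar\Lambda^\sharp(\bar\alpha)=0$; (3) for all sections $\bar\alpha,\bar\beta\in\Gamma(S)$, $\mathcal L_{\bar\Lambda^\sharp(\bar\alpha)}\bar\beta-\mathcal L_{\bar\Lambda^\sharp(\bar\beta)}\bar\alpha-\mathrm d(\bar\beta(\bar\Lambda^\sharp(\bar\alpha)))$ is a section of $S$ and $$[\bar\Lambda^\sharp(\bar\alpha),\bar\Lambda^\sharp(\bar\beta)]=\bar\Lambda^\sharp\bigl(\mathcal L_{\bar\Lambda^\sharp(\bar\alpha)}\bar\beta-\mathcal L_{\bar\Lambda^\sharp(\bar\beta)}\bar\alpha-\mathrm d(\bar\beta(\bar\Lambda^\sharp(\bar\alpha)))\bigr).$$ Let $(M,\omega_1,\dots,\omega_k)$ be a $k$-polysymplectic manifold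 and let a Lie group $G$ act smoothly, freely and properly on $M$, $\Phi\colon G\times M\to M$, with $\Phi_g^*\omega_i=\omega_i$ for all $g\in G$ and all $i$. Then the orbit space $M/G$ has a smooth structure, of dimension $\dim M-\dim G$ (if $M\neq\emptyset$), for which the projection $\pi\colon M\to M/G$ is a submersion. With respect to such a structure let $V\pi=\ker T\pi$, and suppose that i) $S\cap (V\pi)^{\circ k}$ is a vector subbundle of $(T^1_k)^*M$; ii) $(\bar\omega^\flat(p))^{-1}\bigl(((V_p\pi)^\perp)^{\circ k}\cap (V_p\pi)^{\circ k}\cap S(p)\bigr)\subseteq V_p\pi$ for every $p\in M$. Then there is a unique $k$-poly-Poisson structure $(\hat S,\hat\Lambda^\sharp)$ on $M/G$ such that, for every $p\in M$, with $(T_p^*\pi)^k$ denoting $k$ copies of the cotangent map $T_p^*\pi$, $$\hat S(\pi(p))=\{\hat\alpha\in (T^1_k)^*_{\pi(p)}(M/G) : (T_p^*\pi)^k(\hat\alpha)\in S(p)\},\qquad \hat\Lambda^\sharp(\pi(p))=T_p\pi\circ(\bar\omega^\flat(p))^{-1}\circ (T_p^*\pi)^k|_{\hat S(\pi(p))}.$$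 Moreover, $(T^*\pi)^k$ induces an isomorphism of vector bundles over $M/G$ between $\hat S$ and $(S\cap (V\pi)^{\circ k})/G$, the quotient by the lifted action $g\cdot\bar\alpha=(\Phi_{g^{-1}}^*\alpha_1,\dots,\Phi_{g^{-1}}^*\alpha_k)$. -/

import Mathlib

open scoped Manifold ContDiff Topology
open Bundle

noncomputable section

namespace PolyPoisson

section Forms

variable {E : Type*} [NormedAddCommGroup E] [NormedSpace ℝ E] (k : ℕ)
  {N : Type*} [TopologicalSpace N] [ChartedSpace E N]

/-- The fibre at `x` of the bundle of `k`-covelocities `T*N ⊕ ⋯ ⊕ T*N` (`k` summands): a `k`-tuple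
`(α₁, …, α_k)` of covectors at `x` is the `ℝᵏ`-valued covector `v ↦ (α₁ v, …, α_k v)`. -/
abbrev KCovector (E : Type*) [NormedAddCommGroup E] [NormedSpace ℝ E] (k : ℕ)
    {N : Type*} [TopologicalSpace N] [ChartedSpace E N] (x : N) : Type _ :=
  TangentSpace 𝓘(ℝ, E) x →L[ℝ] (Fin k → ℝ)

variable {k}

/-- Smoothness on `U` of a vector field. -/
def SmoothVectorFieldOn [IsManifold 𝓘(ℝ, E) ∞ N]
    (X : ∀ x : N, TangentSpace 𝓘(ℝ, E) x) (U : Set N) : Prop :=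
  ContMDiffOn 𝓘(ℝ, E) (𝓘(ℝ, E).prod 𝓘(ℝ, E)) ∞
    (fun x ↦ TotalSpace.mk' E (E := fun x : N ↦ TangentSpace 𝓘(ℝ, E) x) x (X x)) U

/-- Smoothness on `U` of a section of the bundle of `k`-covelocities. -/
def SmoothKCovectorOn [IsManifold 𝓘(ℝ, E) ∞ N]
    (α : ∀ x : N, KCovector E k x) (U : Set N) : Prop :=
  ContMDiffOn 𝓘(ℝ, E) (𝓘(ℝ, E).prod 𝓘(ℝ, E →L[ℝ] (Fin k → ℝ))) ∞
    (fun x ↦ TotalSpace.mk' (E →L[ℝ] (Fin k → ℝ))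
      (E := fun x : N ↦ TangentSpace 𝓘(ℝ, E) x →L[ℝ] (Fin k → ℝ)) x (α x)) U

/-- The total space of the bundle of `k`-covelocities, with its vector bundle topology. -/
abbrev KCovelocities (E : Type*) [NormedAddCommGroup E] [NormedSpace ℝ E] (k : ℕ)
    (N : Type*) [TopologicalSpace N] [ChartedSpace E N] : Type _ :=
  TotalSpace (E →L[ℝ] (Fin k → ℝ)) (fun x : N ↦ TangentSpace 𝓘(ℝ, E) x →L[ℝ] (Fin k → ℝ))

/-- A family of subspaces of the fibres of the bundle of `k`-covelocities is a smooth vector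
subbundle if it has smooth local frames. -/
def IsSubbundle [IsManifold 𝓘(ℝ, E) ∞ N] (S : ∀ x : N, Submodule ℝ (KCovector E k x)) : Prop :=
  ∀ x₀ : N, ∃ U : Set N, IsOpen U ∧ x₀ ∈ U ∧
    ∃ (r : ℕ) (s : Fin r → ∀ x : N, KCovector E k x),
      (∀ i, SmoothKCovectorOn (s i) U) ∧
      ∀ x ∈ U, LinearIndependent ℝ (fun i ↦ s i x) ∧
        Submodule.span ℝ (Set.range fun i ↦ s i x) = S x

/-- The Lie derivative `𝓛_X α = (𝓛_X α₁, …, 𝓛_X α_k)` at `x₀`, computed in the chart `φ` at `x₀`: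
if `X'` and `α'` are the expressions of `X` and `α` in the chart, then
`(𝓛_X α)' = Dα'(X') + α' ∘ DX'`. -/
def lieDerivAt (X : ∀ x : N, TangentSpace 𝓘(ℝ, E) x) (α : ∀ x : N, KCovector E k x) (x₀ : N) :
    KCovector E k x₀ :=
  let φ := extChartAt 𝓘(ℝ, E) x₀
  let X' : E → E := fun y ↦ VectorField.mpullback 𝓘(ℝ, E) 𝓘(ℝ, E) φ.symm X y
  let α' : E → (E →L[ℝ] (Fin k → ℝ)) := fun y ↦
    (α (φ.symm y)).comp (mfderiv 𝓘(ℝ, E) 𝓘(ℝ, E) φ.symm y)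
  (fderiv ℝ α' (φ x₀) (X' (φ x₀)) + (α' (φ x₀)).comp (fderiv ℝ X' (φ x₀))).comp
    (mfderiv 𝓘(ℝ, E) 𝓘(ℝ, E) φ x₀)

/-- The annihilator `(W°)ᵏ = W° × ⋯ × W°` of a subspace `W` of a tangent space. -/
def annihilator (k : ℕ) {x : N} (W : Submodule ℝ (TangentSpace 𝓘(ℝ, E) x)) :
    Submodule ℝ (KCovector E k x) where
  carrier := {α | ∀ v ∈ W, ∀ A, α v A = 0}
  add_mem' ha hb v hv A := by simp [ha v hv A, hb v hv A]
  zero_mem' v _ A := by simp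
  smul_mem' c a ha v hv A := by simp [ha v hv A]

end Forms

section Structures

variable (E : Type*) [NormedAddCommGroup E] [NormedSpace ℝ E] (k : ℕ)
  (N : Type*) [TopologicalSpace N] [ChartedSpace E N] [IsManifold 𝓘(ℝ, E) ∞ N]

/-- A `k`-polysymplectic structure: a closed nondegenerate `ℝᵏ`-valued `2`-form
`Ω = (Ω₁, …, Ω_k)`. -/
structure PolysymplecticStructure where
  /-- `toFun x X Y = (Ω₁(X, Y), …, Ω_k(X, Y))` -/
  toFun : ∀ x : N, TangentSpace 𝓘(ℝ, E) x →L[ℝ] TangentSpace 𝓘(ℝ, E) x →L[ℝ] (Fin k → ℝ)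
  smooth : ContMDiff 𝓘(ℝ, E) (𝓘(ℝ, E).prod 𝓘(ℝ, E →L[ℝ] E →L[ℝ] (Fin k → ℝ))) ∞
    (fun x ↦ TotalSpace.mk' (E →L[ℝ] E →L[ℝ] (Fin k → ℝ))
      (E := fun x : N ↦
        TangentSpace 𝓘(ℝ, E) x →L[ℝ] TangentSpace 𝓘(ℝ, E) x →L[ℝ] (Fin k → ℝ)) x (toFun x))
  alternating : ∀ (x : N) (v : TangentSpace 𝓘(ℝ, E) x), toFun x v v = 0
  nondegenerate : ∀ (x : N) (v : TangentSpace 𝓘(ℝ, E) x), (∀ A, ∀ w, toFun x v w A = 0) → v = 0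
  /-- `dΩ(X, Y, Z) = 0` for all vector fields, where
  `dΩ(X, Y, Z) = X Ω(Y, Z) - Y Ω(X, Z) + Z Ω(X, Y) - Ω([X, Y], Z) + Ω([X, Z], Y) - Ω([Y, Z], X)`. -/
  closed : ∀ X Y Z : ∀ x : N, TangentSpace 𝓘(ℝ, E) x,
    SmoothVectorFieldOn X Set.univ → SmoothVectorFieldOn Y Set.univ →
    SmoothVectorFieldOn Z Set.univ → ∀ x : N,
      mvfderiv 𝓘(ℝ, E) (fun y ↦ toFun y (Y y) (Z y)) x (X x)
      - mvfderiv 𝓘(ℝ, E) (fun y ↦ toFun y (X y) (Z y)) x (Y x)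
      + mvfderiv 𝓘(ℝ, E) (fun y ↦ toFun y (X y) (Y y)) x (Z x)
      - toFun x (VectorField.mlieBracket 𝓘(ℝ, E) X Y x) (Z x)
      + toFun x (VectorField.mlieBracket 𝓘(ℝ, E) X Z x) (Y x)
      - toFun x (VectorField.mlieBracket 𝓘(ℝ, E) Y Z x) (X x) = 0

/-- A `k`-poly-Poisson structure: a vector subbundle `S` of the bundle of `k`-covelocities and a
vector bundle morphism `Λ♯ : S → TN`. -/
@[ext]
structure PolyPoissonStructure where
  S : ∀ x : N, Submodule ℝ (KCovector E k x)
  sharp : ∀ x : N, S x →ₗ[ℝ] TangentSpace 𝓘(ℝ, E) x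
  isSubbundle : IsSubbundle S
  /-- `Λ♯` is smooth: it takes smooth local sections of `S` to smooth local vector fields. -/
  smooth_sharp : ∀ U : Set N, IsOpen U → ∀ σ : ∀ x : N, S x,
    SmoothKCovectorOn (fun x ↦ (σ x : KCovector E k x)) U →
    SmoothVectorFieldOn (fun x ↦ sharp x (σ x)) U
  skew : ∀ (x : N) (α : S x), (α : KCovector E k x) (sharp x α) = 0
  nondegenerate : ∀ (x : N) (α : S x),
    (∀ β : S x, (α : KCovector E k x) (sharp x β) = 0) → sharp x α = 0
  /-- For sections `α`, `β` of `S`, the `k`-covector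
  `𝓛_{Λ♯α} β - 𝓛_{Λ♯β} α - d(β(Λ♯α))` is in `S` and `Λ♯` takes it to `[Λ♯α, Λ♯β]`. -/
  integrable : ∀ α β : ∀ x : N, S x,
    SmoothKCovectorOn (fun x ↦ (α x : KCovector E k x)) Set.univ →
    SmoothKCovectorOn (fun x ↦ (β x : KCovector E k x)) Set.univ → ∀ x : N,
    ∃ h : lieDerivAt (fun y ↦ sharp y (α y)) (fun y ↦ (β y : KCovector E k y)) x
        - lieDerivAt (fun y ↦ sharp y (β y)) (fun y ↦ (α y : KCovector E k y)) x
        - mvfderiv 𝓘(ℝ, E) (fun y ↦ (β y : KCovector E k y) (sharp y (α y))) x ∈ S x,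
      VectorField.mlieBracket 𝓘(ℝ, E) (fun y ↦ sharp y (α y)) (fun y ↦ sharp y (β y)) x
        = sharp x ⟨_, h⟩

end Structures

namespace PolysymplecticStructure

variable {E : Type*} [NormedAddCommGroup E] [NormedSpace ℝ E] {k : ℕ}
  {M : Type*} [TopologicalSpace M] [ChartedSpace E M] [IsManifold 𝓘(ℝ, E) ∞ M]
  (Ω : PolysymplecticStructure E k M)

/-- The linear map `Ω♭ : T_pM → (T¹_k)*_pM`. -/
def flat (p : M) : TangentSpace 𝓘(ℝ, E) p →ₗ[ℝ] KCovector E k p := (Ω.toFun p).toLinearMap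

/-- The image `S(p)` of `Ω♭` at `p`. -/
def image (p : M) : Submodule ℝ (KCovector E k p) := LinearMap.range (Ω.flat p)

/-- The polysymplectic orthogonal `W^⊥ = ⋂ᵢ (Ωᵢ♭)⁻¹(W°)`. -/
def orthogonal {p : M} (W : Submodule ℝ (TangentSpace 𝓘(ℝ, E) p)) :
    Submodule ℝ (TangentSpace 𝓘(ℝ, E) p) :=
  (annihilator k W).comap (Ω.flat p)

end PolysymplecticStructure

section Reduction

variable {E : Type*} [NormedAddCommGroup E] [NormedSpace ℝ E] {k : ℕ}
  {M : Type*} [TopologicalSpace M] [ChartedSpace E M]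
  (G : Type*) [Group G] [MulAction G M]

/-- The projection onto the orbit space. -/
def proj (p : M) : MulAction.orbitRel.Quotient G M := Quotient.mk _ p

/-- `G` acts by polysymplectic maps: `Φ_g^* Ω_i = Ω_i` for all `g` and `i`. -/
def IsInvariant [IsManifold 𝓘(ℝ, E) ∞ M] (Ω : PolysymplecticStructure E k M) : Prop :=
  ∀ (g : G) (p : M) (u v : TangentSpace 𝓘(ℝ, E) p),
    Ω.toFun (g • p) (mfderiv 𝓘(ℝ, E) 𝓘(ℝ, E) (fun x : M ↦ g • x) p u)
      (mfderiv 𝓘(ℝ, E) 𝓘(ℝ, E) (fun x : M ↦ g • x) p v) = Ω.toFun p u v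

variable (F : Type*) [NormedAddCommGroup F] [NormedSpace ℝ F]
  [ChartedSpace F (MulAction.orbitRel.Quotient G M)]

/-- The tangent map `T_pπ`. -/
def tangentProj (p : M) :
    TangentSpace 𝓘(ℝ, E) p →L[ℝ] TangentSpace 𝓘(ℝ, F) (proj G p) :=
  mfderiv 𝓘(ℝ, E) 𝓘(ℝ, F) (proj (M := M) G) p

/-- The vertical space `V_pπ = ker T_pπ`. -/
def vertical (p : M) : Submodule ℝ (TangentSpace 𝓘(ℝ, E) p) :=
  LinearMap.ker (tangentProj (E := E) G F p).toLinearMap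

/-- `k` copies of the cotangent map `T_p^*π`. -/
def pullProj (p : M) : KCovector F k (proj G p) →ₗ[ℝ] KCovector E k p where
  toFun α := α.comp (tangentProj G F p)
  map_add' _ _ := rfl
  map_smul' _ _ := rfl

/-- The fibres of `S ∩ ((Vπ)°)ᵏ`. -/
def basicImage [IsManifold 𝓘(ℝ, E) ∞ M] (Ω : PolysymplecticStructure E k M) (p : M) :
    Submodule ℝ (KCovector E k p) :=
  Ω.image p ⊓ annihilator k (vertical G F p)

/-- `x` and `y` are related by the lifted action `g · (p, α) = (g p, Φ_{g⁻¹}^* α)`. -/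
def LiftedRel (x y : KCovelocities E k M) : Prop :=
  ∃ (g : G) (p : M) (a : KCovector E k p) (b : KCovector E k (g • p)),
    x = ⟨p, a⟩ ∧ y = ⟨g • p, b⟩ ∧
      b.comp (mfderiv 𝓘(ℝ, E) 𝓘(ℝ, E) (fun z : M ↦ g • z) p) = a

/-- The total space of `S ∩ ((Vπ)°)ᵏ`. -/
abbrev BasicImageTotal [IsManifold 𝓘(ℝ, E) ∞ M] (Ω : PolysymplecticStructure E k M) : Type _ :=
  {x : KCovelocities E k M // x.2 ∈ basicImage G F Ω x.1}

/-- The quotient `(S ∩ ((Vπ)°)ᵏ) / G` by the lifted action, with the quotient topology. -/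
abbrev BasicImageQuotient [IsManifold 𝓘(ℝ, E) ∞ M] (Ω : PolysymplecticStructure E k M) : Type _ :=
  Quot fun x y : BasicImageTotal G F Ω ↦ LiftedRel G x.1 y.1

variable {G F}

/-- `(Ŝ, Λ̂♯)` is the reduction of `Ω`: `Ŝ(π(p))` consists of the `α` with `(T_p^*π)ᵏ α ∈ S(p)`, and
`Λ̂♯(π(p)) = T_pπ ∘ (Ω♭(p))⁻¹ ∘ (T_p^*π)ᵏ`. -/
structure IsReduction [IsManifold 𝓘(ℝ, E) ∞ M]
    [IsManifold 𝓘(ℝ, F) ∞ (MulAction.orbitRel.Quotient G M)]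
    (Ω : PolysymplecticStructure E k M)
    (P : PolyPoissonStructure F k (MulAction.orbitRel.Quotient G M)) : Prop where
  mem_iff : ∀ (p : M) (α : KCovector F k (proj G p)),
    α ∈ P.S (proj G p) ↔ pullProj G F p α ∈ Ω.image p
  sharp_eq : ∀ (p : M) (α : P.S (proj G p)) (X : TangentSpace 𝓘(ℝ, E) p),
    Ω.flat p X = pullProj G F p α → P.sharp (proj G p) α = tangentProj G F p X

/-- `(T^*π)ᵏ` induces an isomorphism of vector bundles over `M / G` between `Ŝ` and
`(S ∩ ((Vπ)°)ᵏ) / G`: it is a linear isomorphism of `Ŝ(π(p))` onto `S(p) ∩ ((V_pπ)°)ᵏ` for each `p`,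
the classes `[p, (T_p^*π)ᵏ α]` and `(π(p), α)` correspond under a homeomorphism of the total spaces,
and the smooth local sections of `Ŝ` are those whose pullbacks (the `G`-invariant sections of
`S ∩ ((Vπ)°)ᵏ`) are smooth. -/
structure IsQuotientBundle [IsManifold 𝓘(ℝ, E) ∞ M]
    [IsManifold 𝓘(ℝ, F) ∞ (MulAction.orbitRel.Quotient G M)]
    (Ω : PolysymplecticStructure E k M)
    (S : ∀ q : MulAction.orbitRel.Quotient G M, Submodule ℝ (KCovector F k q)) : Prop where
  injective : ∀ p : M, Set.InjOn (pullProj (E := E) (k := k) G F p) (S (proj G p))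
  map_eq : ∀ p : M, (S (proj G p)).map (pullProj G F p) = basicImage G F Ω p
  homeomorph : ∃ e : BasicImageQuotient G F Ω ≃ₜ
      {y : KCovelocities F k (MulAction.orbitRel.Quotient G M) // y.2 ∈ S y.1},
    ∀ (x : BasicImageTotal G F Ω) (α : S (proj G x.1.1)),
      pullProj G F x.1.1 α = x.1.2 → e (Quot.mk _ x) = ⟨⟨proj G x.1.1, α⟩, α.2⟩
  smooth_iff : ∀ U : Set (MulAction.orbitRel.Quotient G M), IsOpen U →
    ∀ σ : ∀ q, S q, SmoothKCovectorOn (fun q ↦ (σ q : KCovector F k q)) U ↔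
      SmoothKCovectorOn (fun p : M ↦ pullProj (E := E) (k := k) G F p (σ (proj G p)).1) (proj G ⁻¹' U)

end Reduction

end PolyPoisson

end

noncomputable section

set_option linter.unusedSectionVars false

/-! ### Invertibility and smoothness of linear maps depending on a parameter. -/

section LinearAlgebra

variable {E W : Type*} [NormedAddCommGroup E] [NormedSpace ℝ E]
  [NormedAddCommGroup W] [NormedSpace ℝ W]

/-! Everything on the orbit space is computed by lifting to `M`. If π^*α lies in S(p), nondegeneracy
gives exactly one X with Ω♭X = π^*α, and the reduced morphism sends α to Tπ(X). Invariance of Ω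
makes this independent of the point chosen on the orbit (`exists_flat_eq_pullAt_of_proj_eq`). Since
π^* is injective and its image consists of the covectors that kill Vπ, the reduced fibre corresponds
to S ∩ (Vπ)^{∘k} (`map_pullAt_reducedSubspace`). By hypothesis i) the latter has local frames, and
local sections of the submersion π carry them down to frames of the reduced bundle.

The axioms are then read off from Ω. Skewness is Ω(X, X) = 0. For nondegeneracy, the lifts of
elements of the reduced fibre are exactly the vectors of (Vπ)^⊥; so if α vanishes on the whole image
of the reduced morphism, then Ω♭X kills (Vπ)^⊥, and hypothesis ii) makes X vertical. For
integrability, closedness of Ω amounts to i_{[X,Y]}Ω = 𝓛_X i_YΩ - 𝓛_Y i_XΩ - d(Ω(Y, X))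
(`flat_mlieBracket`). The lifts are π-related to the reduced vector fields, and brackets, Lie
derivatives and differentials are natural for related fields (`mfderiv_mlieBracket_of_related`,
`lieDerivAt_pullback`), so this identity is the π-pullback of the one required below. Since π is
surjective, the two defining formulas leave no freedom, whence uniqueness.

The bundle isomorphism comes from the map (p, π^*α) ↦ (π(p), α): it is a continuous open surjection
whose fibres are the orbits of the lifted action.

For the smooth structure, freeness makes orbit maps immersive at the identity
(`injective_mfderiv_orbitMap`), so the inverse function theorem gives coordinates (w, u) near p in
which w moves along a slice and u along the group. Properness forces two nearby slice points of one
orbit to differ by a group element near 1, hence to coincide. Thus w separates the orbits near p and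
descends to a chart of `M / G`. -/

theorem ContinuousLinearMap.exists_leftInverse_of_injective_of_finiteDimensional
    [FiniteDimensional ℝ W] (A : E →L[ℝ] W) (hA : Function.Injective A) :
    ∃ L : W →L[ℝ] E, L ∘L A = ContinuousLinearMap.id ℝ E := by
  obtain ⟨L, hL⟩ := LinearMap.exists_leftInverse_of_injective A.toLinearMap
    (LinearMap.ker_eq_bot.2 hA)
  exact ⟨L.toContinuousLinearMap, ContinuousLinearMap.ext fun v ↦ LinearMap.congr_fun hL v⟩

theorem ContinuousLinearMap.eventually_isInvertible_nhds_id [FiniteDimensional ℝ E] :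
    ∀ᶠ T : E →L[ℝ] E in 𝓝 (ContinuousLinearMap.id ℝ E), T.IsInvertible := by
  have : CompleteSpace E := FiniteDimensional.complete ℝ E
  filter_upwards [(ContinuousLinearEquiv.refl ℝ E).nhds] with T hT
  exact hT

theorem ContinuousLinearMap.contDiffAt_inverse_id [FiniteDimensional ℝ E] {n : WithTop ℕ∞} :
    ContDiffAt ℝ n (ContinuousLinearMap.inverse : (E →L[ℝ] E) → (E →L[ℝ] E))
      (ContinuousLinearMap.id ℝ E) := by
  have : CompleteSpace E := FiniteDimensional.complete ℝ E
  exact contDiffAt_map_inverse (ContinuousLinearEquiv.refl ℝ E)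

end LinearAlgebra

/-! ### Smoothness through injective bundle morphisms. -/

section Bundles
variable {B F₁ F₂ M EB HB EM HM : Type*} {E₁ : B → Type*} {E₂ : B → Type*}
  [∀ x, AddCommGroup (E₁ x)] [∀ x, Module ℝ (E₁ x)] [NormedAddCommGroup F₁] [NormedSpace ℝ F₁]
  [TopologicalSpace (TotalSpace F₁ E₁)] [∀ x, TopologicalSpace (E₁ x)]
  [∀ x, AddCommGroup (E₂ x)] [∀ x, Module ℝ (E₂ x)] [NormedAddCommGroup F₂] [NormedSpace ℝ F₂]
  [TopologicalSpace (TotalSpace F₂ E₂)] [∀ x, TopologicalSpace (E₂ x)]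
  [∀ x, IsTopologicalAddGroup (E₂ x)] [∀ x, ContinuousSMul ℝ (E₂ x)]
  [NormedAddCommGroup EB] [NormedSpace ℝ EB] [TopologicalSpace HB]
  {IB : ModelWithCorners ℝ EB HB} [TopologicalSpace B] [ChartedSpace HB B]
  [FiberBundle F₁ E₁] [VectorBundle ℝ F₁ E₁] [FiberBundle F₂ E₂] [VectorBundle ℝ F₂ E₂]
  {n : WithTop ℕ∞}

/-- In trivialisations at `x₀` the morphism becomes a family of matrices `A x`. A left inverse `L`
of `A x₀` makes `L ∘ A x` the identity at `x₀`, hence invertible nearby with smooth inverse, and v =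
(L A)⁻¹ L (A v). -/
theorem ContMDiffAt.of_clm_bundle_apply [FiniteDimensional ℝ F₁] [FiniteDimensional ℝ F₂]
    {ϕ : ∀ x : B, E₁ x →L[ℝ] E₂ x} {v : ∀ x, E₁ x} {x₀ : B}
    (hϕ : ContMDiffAt IB (IB.prod 𝓘(ℝ, F₁ →L[ℝ] F₂)) n
      (fun x ↦ TotalSpace.mk' (F₁ →L[ℝ] F₂) (E := fun x ↦ E₁ x →L[ℝ] E₂ x) x (ϕ x)) x₀)
    (hinj : Function.Injective (ϕ x₀))
    (h : ContMDiffAt IB (IB.prod 𝓘(ℝ, F₂)) n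
      (fun x ↦ TotalSpace.mk' F₂ (E := E₂) x (ϕ x (v x))) x₀) :
    ContMDiffAt IB (IB.prod 𝓘(ℝ, F₁)) n (fun x ↦ TotalSpace.mk' F₁ (E := E₁) x (v x)) x₀ := by
  rw [contMDiffAt_totalSpace] at h ⊢
  rw [contMDiffAt_hom_bundle] at hϕ
  refine ⟨contMDiffAt_id, ?_⟩
  set A : B → F₁ →L[ℝ] F₂ := fun x ↦ ContinuousLinearMap.inCoordinates F₁ E₁ F₂ E₂ x₀ x x₀ x (ϕ x)
  have hx₁ := mem_baseSet_trivializationAt F₁ E₁ x₀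
  have hx₂ := mem_baseSet_trivializationAt F₂ E₂ x₀
  have hA₀ : Function.Injective (A x₀) := by
    simp only [A, ContinuousLinearMap.inCoordinates_eq hx₁ hx₂]
    exact ((Trivialization.continuousLinearEquivAt ℝ _ _ hx₂).injective.comp hinj).comp
      (Trivialization.continuousLinearEquivAt ℝ _ _ hx₁).symm.injective
  obtain ⟨L, hL⟩ := (A x₀).exists_leftInverse_of_injective_of_finiteDimensional hA₀
  have hLA : ContMDiffAt IB 𝓘(ℝ, F₁ →L[ℝ] F₁) n (fun x ↦ L ∘L A x) x₀ :=
    contMDiffAt_const.clm_comp hϕ.2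
  have hinv : ContMDiffAt IB 𝓘(ℝ, F₁ →L[ℝ] F₁) n (fun x ↦ (L ∘L A x).inverse) x₀ := by
    refine ContDiffAt.comp_contMDiffAt (g := ContinuousLinearMap.inverse) ?_ hLA
    rw [hL]
    exact ContinuousLinearMap.contDiffAt_inverse_id
  have hunit : ∀ᶠ x in 𝓝 x₀, (L ∘L A x).IsInvertible := by
    refine hLA.continuousAt.eventually (p := fun T ↦ T.IsInvertible) ?_
    simp only [hL]
    exact ContinuousLinearMap.eventually_isInvertible_nhds_id
  refine (hinv.clm_apply ((contMDiffAt_const (c := L)).clm_apply h.2)).congr_of_eventuallyEq ?_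
  filter_upwards [hunit, (trivializationAt F₁ E₁ x₀).open_baseSet.mem_nhds hx₁,
    (trivializationAt F₂ E₂ x₀).open_baseSet.mem_nhds hx₂] with x hx h₁ h₂
  have : ((trivializationAt F₂ E₂ x₀) ⟨x, ϕ x (v x)⟩).2 =
      A x ((trivializationAt F₁ E₁ x₀) ⟨x, v x⟩).2 := by
    simp only [A, ContinuousLinearMap.inCoordinates_eq h₁ h₂]
    simp [h₁]
  change _ = (L ∘L A x).inverse (L ((trivializationAt F₂ E₂ x₀) ⟨x, ϕ x (v x)⟩).2)
  rw [this, ← ContinuousLinearMap.comp_apply L]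
  exact (hx.inverse_apply_eq.2 rfl).symm
end Bundles
section
variable {B₁ B₂ B₃ F₁ F₂ F₃ : Type*} {E₁ : B₁ → Type*} {E₂ : B₂ → Type*} {E₃ : B₃ → Type*}
  [∀ x, AddCommGroup (E₁ x)] [∀ x, Module ℝ (E₁ x)] [NormedAddCommGroup F₁] [NormedSpace ℝ F₁]
  [TopologicalSpace (TotalSpace F₁ E₁)] [∀ x, TopologicalSpace (E₁ x)]
  [∀ x, AddCommGroup (E₂ x)] [∀ x, Module ℝ (E₂ x)] [NormedAddCommGroup F₂] [NormedSpace ℝ F₂]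
  [TopologicalSpace (TotalSpace F₂ E₂)] [∀ x, TopologicalSpace (E₂ x)]
  [∀ x, AddCommGroup (E₃ x)] [∀ x, Module ℝ (E₃ x)] [NormedAddCommGroup F₃] [NormedSpace ℝ F₃]
  [TopologicalSpace (TotalSpace F₃ E₃)] [∀ x, TopologicalSpace (E₃ x)]
  [TopologicalSpace B₁] [TopologicalSpace B₂] [TopologicalSpace B₃]
  [FiberBundle F₁ E₁] [VectorBundle ℝ F₁ E₁] [FiberBundle F₂ E₂] [VectorBundle ℝ F₂ E₂]
  [FiberBundle F₃ E₃] [VectorBundle ℝ F₃ E₃]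

theorem ContinuousLinearMap.inCoordinates_comp {x₀ x : B₁} {y₀ y : B₂} {z₀ z : B₃}
    (ψ : E₂ y →L[ℝ] E₃ z) (ϕ : E₁ x →L[ℝ] E₂ y)
    (hy : y ∈ (trivializationAt F₂ E₂ y₀).baseSet) :
    inCoordinates F₁ E₁ F₃ E₃ x₀ x z₀ z (ψ ∘L ϕ) =
      inCoordinates F₂ E₂ F₃ E₃ y₀ y z₀ z ψ ∘L inCoordinates F₁ E₁ F₂ E₂ x₀ x y₀ y ϕ := by
  ext v
  simp [inCoordinates, hy]
end


/-! ### Smooth and continuous `k`-covector fields under pullback. -/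

namespace PolyPoisson

section Smoothness

variable {E F : Type*} [NormedAddCommGroup E] [NormedSpace ℝ E] [NormedAddCommGroup F]
  [NormedSpace ℝ F] {k : ℕ}
  {M : Type*} [TopologicalSpace M] [ChartedSpace E M] [IsManifold 𝓘(ℝ, E) ∞ M]
  {N : Type*} [TopologicalSpace N] [ChartedSpace F N] [IsManifold 𝓘(ℝ, F) ∞ N]

/-- Smoothness of a vector field at a point. -/
def SmoothVectorFieldAt (X : ∀ x : M, TangentSpace 𝓘(ℝ, E) x) (x₀ : M) : Prop :=
  ContMDiffAt 𝓘(ℝ, E) (𝓘(ℝ, E).prod 𝓘(ℝ, E)) ∞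
    (fun x ↦ TotalSpace.mk' E (E := fun x : M ↦ TangentSpace 𝓘(ℝ, E) x) x (X x)) x₀

/-- Smoothness of a `k`-covector field at a point. -/
def SmoothKCovectorAt (α : ∀ x : M, KCovector E k x) (x₀ : M) : Prop :=
  ContMDiffAt 𝓘(ℝ, E) (𝓘(ℝ, E).prod 𝓘(ℝ, E →L[ℝ] (Fin k → ℝ))) ∞
    (fun x ↦ TotalSpace.mk' (E →L[ℝ] (Fin k → ℝ))
      (E := fun x : M ↦ TangentSpace 𝓘(ℝ, E) x →L[ℝ] (Fin k → ℝ)) x (α x)) x₀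

theorem smoothVectorFieldOn_iff {X : ∀ x : M, TangentSpace 𝓘(ℝ, E) x} {U : Set M}
    (hU : IsOpen U) : SmoothVectorFieldOn X U ↔ ∀ x ∈ U, SmoothVectorFieldAt X x :=
  ⟨fun h x hx ↦ (h x hx).contMDiffAt (hU.mem_nhds hx), fun h x hx ↦ (h x hx).contMDiffWithinAt⟩

theorem smoothKCovectorOn_iff {α : ∀ x : M, KCovector E k x} {U : Set M}
    (hU : IsOpen U) : SmoothKCovectorOn α U ↔ ∀ x ∈ U, SmoothKCovectorAt α x :=
  ⟨fun h x hx ↦ (h x hx).contMDiffAt (hU.mem_nhds hx), fun h x hx ↦ (h x hx).contMDiffWithinAt⟩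

theorem SmoothVectorFieldAt.congr {X Y : ∀ x : M, TangentSpace 𝓘(ℝ, E) x} {x₀ : M}
    (h : SmoothVectorFieldAt X x₀) (hXY : ∀ᶠ x in 𝓝 x₀, Y x = X x) :
    SmoothVectorFieldAt Y x₀ :=
  h.congr_of_eventuallyEq (hXY.mono fun x hx ↦ by simp only [hx])

theorem SmoothKCovectorAt.congr {α β : ∀ x : M, KCovector E k x} {x₀ : M}
    (h : SmoothKCovectorAt α x₀) (hαβ : ∀ᶠ x in 𝓝 x₀, β x = α x) : SmoothKCovectorAt β x₀ :=
  h.congr_of_eventuallyEq (hαβ.mono fun x hx ↦ by simp only [hx])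

/-- The pullback of a smooth `k`-covector field by a smooth map is smooth. -/
theorem SmoothKCovectorAt.pullback {f : M → N} {x₀ : M} {α : ∀ y : N, KCovector F k y}
    (hα : SmoothKCovectorAt α (f x₀)) (hf : ContMDiffAt 𝓘(ℝ, E) 𝓘(ℝ, F) ∞ f x₀) :
    SmoothKCovectorAt (fun x ↦ (α (f x)).comp (mfderiv 𝓘(ℝ, E) 𝓘(ℝ, F) f x)) x₀ := by
  unfold SmoothKCovectorAt at *
  rw [contMDiffAt_hom_bundle] at *
  refine ⟨contMDiffAt_id, ?_⟩
  have h₁ := hα.2.comp x₀ hf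
  have h₂ : ContMDiffAt 𝓘(ℝ, E) 𝓘(ℝ, E →L[ℝ] F) ∞
      (inTangentCoordinates 𝓘(ℝ, E) 𝓘(ℝ, F) id f (mfderiv 𝓘(ℝ, E) 𝓘(ℝ, F) f) x₀) x₀ :=
    hf.mfderiv_const le_rfl
  refine (h₁.clm_comp h₂).congr_of_eventuallyEq ?_
  have : ∀ᶠ x in 𝓝 x₀, f x ∈ (trivializationAt F (TangentSpace 𝓘(ℝ, F)) (f x₀)).baseSet :=
    hf.continuousAt ((trivializationAt F (TangentSpace 𝓘(ℝ, F)) (f x₀)).open_baseSet.mem_nhds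
      (mem_baseSet_trivializationAt F _ (f x₀)))
  filter_upwards [this] with x hx
  exact ContinuousLinearMap.inCoordinates_comp (F₁ := E) (F₂ := F) (F₃ := Fin k → ℝ)
    (E₁ := fun x : M ↦ TangentSpace 𝓘(ℝ, E) x) (E₂ := fun x : N ↦ TangentSpace 𝓘(ℝ, F) x)
    (E₃ := fun _ : N ↦ (Fin k → ℝ)) _ _ hx

/-- If `Ω♭ X` is a smooth `k`-covector field, then `X` is a smooth vector field. -/
theorem PolysymplecticStructure.smoothVectorFieldAt_of_flat [FiniteDimensional ℝ E]
    (Ω : PolysymplecticStructure E k M) {X : ∀ x : M, TangentSpace 𝓘(ℝ, E) x} {x₀ : M}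
    (h : SmoothKCovectorAt (fun x ↦ Ω.flat x (X x)) x₀) : SmoothVectorFieldAt X x₀ := by
  refine ContMDiffAt.of_clm_bundle_apply (F₂ := E →L[ℝ] (Fin k → ℝ))
    (E₂ := fun x : M ↦ TangentSpace 𝓘(ℝ, E) x →L[ℝ] (Fin k → ℝ)) (Ω.smooth x₀) ?_ h
  rw [injective_iff_map_eq_zero]
  exact fun v hv ↦ Ω.nondegenerate x₀ v fun A w ↦ by rw [hv]; rfl

theorem PolysymplecticStructure.flat_injective
    (Ω : PolysymplecticStructure E k M) (p : M) : Function.Injective (Ω.flat p) := by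
  rw [injective_iff_map_eq_zero]
  exact fun v hv ↦ Ω.nondegenerate p v fun A w ↦ congrFun (DFunLike.congr_fun hv w) A

variable {Z : Type*} [TopologicalSpace Z]

/-- Continuity of a composition `α z ∘ ϕ z`, where `α z` is a `k`-covector. -/
theorem continuousAt_kCovector_comp {b : Z → N} {c : Z → M} {z₀ : Z}
    {α : ∀ z, KCovector F k (b z)}
    {ϕ : ∀ z, TangentSpace 𝓘(ℝ, E) (c z) →L[ℝ] TangentSpace 𝓘(ℝ, F) (b z)}
    (hα : ContinuousAt (fun z ↦ (⟨b z, α z⟩ : KCovelocities F k N)) z₀) (hc : ContinuousAt c z₀)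
    (hϕ : ContinuousAt (fun z ↦ ContinuousLinearMap.inCoordinates E
      (fun x : M ↦ TangentSpace 𝓘(ℝ, E) x) F (fun x : N ↦ TangentSpace 𝓘(ℝ, F) x)
      (c z₀) (c z) (b z₀) (b z) (ϕ z)) z₀) :
    ContinuousAt (fun z ↦ (⟨c z, (α z).comp (ϕ z)⟩ : KCovelocities E k M)) z₀ := by
  rw [continuousAt_hom_bundle] at *
  refine ⟨hc, ?_⟩
  refine (hα.2.clm_comp hϕ).congr ?_
  have : ∀ᶠ z in 𝓝 z₀, b z ∈ (trivializationAt F (TangentSpace 𝓘(ℝ, F)) (b z₀)).baseSet :=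
    hα.1 ((trivializationAt F (TangentSpace 𝓘(ℝ, F)) (b z₀)).open_baseSet.mem_nhds
      (mem_baseSet_trivializationAt F _ (b z₀)))
  filter_upwards [this] with z hz
  exact (ContinuousLinearMap.inCoordinates_comp (F₁ := E) (F₂ := F) (F₃ := Fin k → ℝ)
    (E₁ := fun x : M ↦ TangentSpace 𝓘(ℝ, E) x) (E₂ := fun x : N ↦ TangentSpace 𝓘(ℝ, F) x)
    (E₃ := fun _ : N ↦ (Fin k → ℝ)) _ _ hz).symm

/-- If `α z ∘ ϕ z` depends continuously on `z` and `ϕ z₀` is surjective, then `α z` depends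
continuously on `z` at `z₀`. -/
theorem continuousAt_kCovector_of_comp [FiniteDimensional ℝ F] {b : Z → N} {c : Z → M} {z₀ : Z}
    {α : ∀ z, KCovector F k (b z)}
    {ϕ : ∀ z, TangentSpace 𝓘(ℝ, E) (c z) →L[ℝ] TangentSpace 𝓘(ℝ, F) (b z)}
    (hα : ContinuousAt (fun z ↦ (⟨c z, (α z).comp (ϕ z)⟩ : KCovelocities E k M)) z₀)
    (hb : ContinuousAt b z₀)
    (hϕ : ContinuousAt (fun z ↦ ContinuousLinearMap.inCoordinates E
      (fun x : M ↦ TangentSpace 𝓘(ℝ, E) x) F (fun x : N ↦ TangentSpace 𝓘(ℝ, F) x)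
      (c z₀) (c z) (b z₀) (b z) (ϕ z)) z₀)
    (hsurj : Function.Surjective (ϕ z₀)) :
    ContinuousAt (fun z ↦ (⟨b z, α z⟩ : KCovelocities F k N)) z₀ := by
  rw [continuousAt_hom_bundle] at *
  refine ⟨hb, ?_⟩
  set A : Z → E →L[ℝ] F := fun z ↦ ContinuousLinearMap.inCoordinates E
      (fun x : M ↦ TangentSpace 𝓘(ℝ, E) x) F (fun x : N ↦ TangentSpace 𝓘(ℝ, F) x)
      (c z₀) (c z) (b z₀) (b z) (ϕ z)
  have hA₀ : Function.Surjective (A z₀) := by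
    simp only [A]
    rw [ContinuousLinearMap.inCoordinates_eq (mem_baseSet_trivializationAt E _ (c z₀))
      (mem_baseSet_trivializationAt F _ (b z₀))]
    exact ((Trivialization.continuousLinearEquivAt ℝ _ _
      (mem_baseSet_trivializationAt F _ (b z₀))).surjective.comp hsurj).comp
      (Trivialization.continuousLinearEquivAt ℝ _ _ _).symm.surjective
  -- `A z ∘ R` is the identity at `z₀`, so it is invertible nearby and α can be recovered as (α ∘ A)
  -- ∘ R ∘ (A R)⁻¹.
  obtain ⟨R, hR⟩ := (A z₀).exists_rightInverse_of_surjective (LinearMap.range_eq_top.2 hA₀)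
  have hAR : ContinuousAt (fun z ↦ A z ∘L R) z₀ := hϕ.clm_comp continuousAt_const
  have hinv : ContinuousAt (fun z ↦ (A z ∘L R).inverse) z₀ := by
    refine ContinuousAt.comp (g := ContinuousLinearMap.inverse) ?_ hAR
    rw [hR]
    exact (ContinuousLinearMap.contDiffAt_inverse_id (n := 0)).continuousAt
  have hunit : ∀ᶠ z in 𝓝 z₀, (A z ∘L R).IsInvertible := by
    refine hAR.eventually (p := fun T ↦ T.IsInvertible) ?_
    simp only [hR]
    exact ContinuousLinearMap.eventually_isInvertible_nhds_id
  refine (hα.2.clm_comp ((continuousAt_const (y := R)).clm_comp hinv)).congr ?_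
  have : ∀ᶠ z in 𝓝 z₀, b z ∈ (trivializationAt F (TangentSpace 𝓘(ℝ, F)) (b z₀)).baseSet :=
    hb ((trivializationAt F (TangentSpace 𝓘(ℝ, F)) (b z₀)).open_baseSet.mem_nhds
      (mem_baseSet_trivializationAt F _ (b z₀)))
  filter_upwards [this, hunit] with z hz hz'
  have key := ContinuousLinearMap.inCoordinates_comp (F₁ := E) (F₂ := F) (F₃ := Fin k → ℝ)
    (E₁ := fun x : M ↦ TangentSpace 𝓘(ℝ, E) x) (E₂ := fun x : N ↦ TangentSpace 𝓘(ℝ, F) x)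
    (E₃ := fun _ : N ↦ (Fin k → ℝ)) (x₀ := c z₀) (z₀ := b z₀) (z := b z) (α z) (ϕ z) hz
  have key' : ContinuousLinearMap.inCoordinates E (fun x : M ↦ TangentSpace 𝓘(ℝ, E) x)
      (Fin k → ℝ) (fun _ : M ↦ (Fin k → ℝ)) (c z₀) (c z) (c z₀) (c z) ((α z).comp (ϕ z)) =
      ContinuousLinearMap.inCoordinates F (fun x : N ↦ TangentSpace 𝓘(ℝ, F) x)
      (Fin k → ℝ) (fun _ : N ↦ (Fin k → ℝ)) (b z₀) (b z) (b z₀) (b z) (α z) ∘L A z := key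
  refine (congrArg (fun T ↦ T ∘L (R ∘L (A z ∘L R).inverse)) key').trans ?_
  ext v j
  have := DFunLike.congr_fun hz'.self_comp_inverse v
  simp only [ContinuousLinearMap.comp_apply, ContinuousLinearMap.id_apply] at this ⊢
  rw [this]

end Smoothness

end PolyPoisson

/-! ### Naturality of brackets and Lie derivatives on vector spaces. -/

section VectorSpace

open VectorField

variable {E F W : Type*} [NormedAddCommGroup E] [NormedSpace ℝ E] [NormedAddCommGroup F]
  [NormedSpace ℝ F] [NormedAddCommGroup W] [NormedSpace ℝ W]
  {f : E → F} {x : E} {X Y : E → E} {X' Y' : F → F}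

/-- Differentiating the relation `Df X = X' ∘ f`. -/
theorem fderiv_fderiv_apply_of_related (hf : ContDiffAt ℝ 2 f x) (hX : DifferentiableAt ℝ X x)
    (hX' : DifferentiableAt ℝ X' (f x)) (h : ∀ᶠ y in 𝓝 x, fderiv ℝ f y (X y) = X' (f y)) (v : E) :
    fderiv ℝ (fderiv ℝ f) x v (X x) + fderiv ℝ f x (fderiv ℝ X x v) =
      fderiv ℝ X' (f x) (fderiv ℝ f x v) := by
  have hdf : DifferentiableAt ℝ (fderiv ℝ f) x :=
    (hf.fderiv_right (m := 1) (by norm_num)).differentiableAt one_ne_zero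
  have h₁ := hdf.hasFDerivAt.clm_apply hX.hasFDerivAt
  have h₂ := hX'.hasFDerivAt.comp x (hf.differentiableAt two_ne_zero).hasFDerivAt
  have := (h₁.congr_of_eventuallyEq (h.mono fun y hy ↦ hy.symm)).unique h₂
  have := DFunLike.congr_fun this v
  simpa [add_comm] using this

/-- Differentiating both relations produces the terms D²f(Y, X) and D²f(X, Y), which cancel by
symmetry of the second derivative. -/
theorem fderiv_lieBracket_of_related (hf : ContDiffAt ℝ 2 f x) (hX : DifferentiableAt ℝ X x)
    (hY : DifferentiableAt ℝ Y x) (hX' : DifferentiableAt ℝ X' (f x))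
    (hY' : DifferentiableAt ℝ Y' (f x)) (h : ∀ᶠ y in 𝓝 x, fderiv ℝ f y (X y) = X' (f y))
    (h' : ∀ᶠ y in 𝓝 x, fderiv ℝ f y (Y y) = Y' (f y)) :
    fderiv ℝ f x (lieBracket ℝ X Y x) = lieBracket ℝ X' Y' (f x) := by
  have h₁ := fderiv_fderiv_apply_of_related hf hX hX' h (Y x)
  have h₂ := fderiv_fderiv_apply_of_related hf hY hY' h' (X x)
  have h₃ := hf.isSymmSndFDerivAt (by simp) (X x) (Y x)
  simp only [lieBracket, map_sub, ← h.self_of_nhds, ← h'.self_of_nhds, ← h₁, ← h₂, h₃]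
  abel

/-- The Lie derivative of a vector-valued one-form along a vector field on a vector space. -/
def lieDerivForm (X : E → E) (α : E → E →L[ℝ] W) (x : E) : E →L[ℝ] W :=
  fderiv ℝ α x (X x) + (α x).comp (fderiv ℝ X x)

/-- Differentiating the factor Df in f^*α' yields α'(D²f(X, v)). By symmetry this is exactly the
term by which Df ∘ DX differs from DX' ∘ Df. -/
theorem lieDerivForm_of_related {α : E → E →L[ℝ] W} {α' : F → F →L[ℝ] W}
    (hf : ContDiffAt ℝ 2 f x) (hX : DifferentiableAt ℝ X x) (hX' : DifferentiableAt ℝ X' (f x))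
    (hα' : DifferentiableAt ℝ α' (f x)) (h : ∀ᶠ y in 𝓝 x, fderiv ℝ f y (X y) = X' (f y))
    (h' : ∀ᶠ y in 𝓝 x, α y = (α' (f y)).comp (fderiv ℝ f y)) :
    lieDerivForm X α x = (lieDerivForm X' α' (f x)).comp (fderiv ℝ f x) := by
  have hdf : DifferentiableAt ℝ (fderiv ℝ f) x :=
    (hf.fderiv_right (m := 1) (by norm_num)).differentiableAt one_ne_zero
  have hf' := (hf.differentiableAt two_ne_zero).hasFDerivAt
  have h₁ := ((hα'.hasFDerivAt.comp x hf').clm_comp hdf.hasFDerivAt).congr_of_eventuallyEq h'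
  ext v
  have h₂ := fderiv_fderiv_apply_of_related hf hX hX' h v
  have h₃ := hf.isSymmSndFDerivAt (by simp) (X x) v
  simp only [lieDerivForm, h₁.fderiv, h'.self_of_nhds, add_apply,
    ContinuousLinearMap.comp_apply, ← h₂, ← h.self_of_nhds]
  simp [h₃]
  abel

theorem lieDerivForm_apply {α : E → E →L[ℝ] W} {Z : E → E} (hα : DifferentiableAt ℝ α x)
    (hZ : DifferentiableAt ℝ Z x) :
    lieDerivForm X α x (Z x) =
      fderiv ℝ (fun y ↦ α y (Z y)) x (X x) - α x (lieBracket ℝ X Z x) := by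
  have := (hα.hasFDerivAt.clm_apply hZ.hasFDerivAt).fderiv
  simp [lieDerivForm, this, lieBracket]

end VectorSpace

/-! ### Transfer to manifolds through charts. -/

namespace PolyPoisson

open VectorField

section Charts

variable {E F : Type*} [NormedAddCommGroup E] [NormedSpace ℝ E] [NormedAddCommGroup F]
  [NormedSpace ℝ F] {k : ℕ}
  {M : Type*} [TopologicalSpace M] [ChartedSpace E M]
  {N : Type*} [TopologicalSpace N] [ChartedSpace F N]

/-- The expression of a vector field in the chart at `x₀`. -/
def chartField (x₀ : M) (X : ∀ x : M, TangentSpace 𝓘(ℝ, E) x) : E → E := fun y ↦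
  mpullback 𝓘(ℝ, E) 𝓘(ℝ, E) (extChartAt 𝓘(ℝ, E) x₀).symm X y

/-- The expression of a `k`-covector field in the chart at `x₀`. -/
def chartForm (x₀ : M) (α : ∀ x : M, KCovector E k x) : E → (E →L[ℝ] (Fin k → ℝ)) := fun y ↦
  (α ((extChartAt 𝓘(ℝ, E) x₀).symm y)).comp
    (mfderiv 𝓘(ℝ, E) 𝓘(ℝ, E) (extChartAt 𝓘(ℝ, E) x₀).symm y)

variable [IsManifold 𝓘(ℝ, E) ∞ M] [IsManifold 𝓘(ℝ, F) ∞ N]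

theorem isInvertible_mfderiv_extChartAt_symm (x₀ : M) {y : E}
    (hy : y ∈ (extChartAt 𝓘(ℝ, E) x₀).target) :
    (mfderiv 𝓘(ℝ, E) 𝓘(ℝ, E) (extChartAt 𝓘(ℝ, E) x₀).symm y).IsInvertible := by
  have : IsManifold 𝓘(ℝ, E) 1 M := .of_le (n := ∞) (by simp)
  simpa using isInvertible_mfderivWithin_extChartAt_symm (I := 𝓘(ℝ, E)) hy

/-- The tangent space at `x₀` is identified with `E` by the preferred chart at `x₀`. Hence
quantities evaluated at the base point agree with their chart expressions without any correction
factor. -/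
theorem mfderiv_extChartAt_symm_self (x₀ : M) :
    mfderiv 𝓘(ℝ, E) 𝓘(ℝ, E) (extChartAt 𝓘(ℝ, E) x₀).symm (extChartAt 𝓘(ℝ, E) x₀ x₀) =
      ContinuousLinearMap.id ℝ E := by
  have : IsManifold 𝓘(ℝ, E) 1 M := .of_le (n := ∞) (by simp)
  simpa using! mfderivWithin_range_extChartAt_symm (I := 𝓘(ℝ, E)) (x := x₀)

theorem chartField_self (x₀ : M) (X : ∀ x : M, TangentSpace 𝓘(ℝ, E) x) :
    chartField x₀ X (extChartAt 𝓘(ℝ, E) x₀ x₀) = X x₀ := by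
  have : IsManifold 𝓘(ℝ, E) 1 M := .of_le (n := ∞) (by simp)
  simp only [chartField, mpullback_apply]
  rw [extChartAt_to_inv]
  have := mfderivWithin_extChartAt_symm_inverse_apply (I := 𝓘(ℝ, E)) (x := x₀) (X x₀)
  simpa using! this

theorem chartForm_self (x₀ : M) (α : ∀ x : M, KCovector E k x) :
    chartForm x₀ α (extChartAt 𝓘(ℝ, E) x₀ x₀) = α x₀ := by
  simp only [chartForm]
  rw [extChartAt_to_inv]
  exact (congrArg (fun T ↦ ContinuousLinearMap.comp (α x₀) T)
    (mfderiv_extChartAt_symm_self x₀)).trans (ContinuousLinearMap.comp_id _)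

theorem mfderiv_extChartAt_symm_chartField (x₀ : M) (X : ∀ x : M, TangentSpace 𝓘(ℝ, E) x) {y : E}
    (hy : y ∈ (extChartAt 𝓘(ℝ, E) x₀).target) :
    mfderiv 𝓘(ℝ, E) 𝓘(ℝ, E) (extChartAt 𝓘(ℝ, E) x₀).symm y (chartField (E := E) x₀ X y) =
      X ((extChartAt 𝓘(ℝ, E) x₀).symm y) := by
  have h := isInvertible_mfderiv_extChartAt_symm x₀ hy
  obtain ⟨e, he⟩ := h
  simp only [chartField, mpullback_apply, ← he, ContinuousLinearMap.inverse_equiv]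
  exact e.apply_symm_apply _

theorem mlieBracket_eq_lieBracket_chartField (X Y : ∀ x : M, TangentSpace 𝓘(ℝ, E) x) (x₀ : M) :
    mlieBracket 𝓘(ℝ, E) X Y x₀ =
      lieBracket ℝ (chartField x₀ X) (chartField x₀ Y) (extChartAt 𝓘(ℝ, E) x₀ x₀) := by
  have : IsManifold 𝓘(ℝ, E) 1 M := .of_le (n := ∞) (by simp)
  rw [← mlieBracketWithin_univ, mlieBracketWithin_apply, mfderiv_extChartAt_self]
  change (ContinuousLinearMap.id ℝ E).inverse _ = _
  rw [ContinuousLinearMap.inverse_id]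
  simp only [modelWithCornersSelf_coe, Set.range_id, Set.preimage_univ, Set.inter_univ,
    mpullbackWithin_univ]
  exact congrFun (lieBracketWithin_univ (V := chartField x₀ X) (W := chartField x₀ Y)) _

theorem lieDerivAt_eq_lieDerivForm (X : ∀ x : M, TangentSpace 𝓘(ℝ, E) x)
    (α : ∀ x : M, KCovector E k x) (x₀ : M) :
    lieDerivAt X α x₀ =
      lieDerivForm (chartField x₀ X) (chartForm x₀ α) (extChartAt 𝓘(ℝ, E) x₀ x₀) := by
  have : IsManifold 𝓘(ℝ, E) 1 M := .of_le (n := ∞) (by simp)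
  have h := mfderiv_extChartAt_self (I := 𝓘(ℝ, E)) (x := x₀)
  simp only [lieDerivAt]
  rw [h]
  exact ContinuousLinearMap.comp_id _

theorem SmoothVectorFieldAt.contDiffAt_chartField [CompleteSpace E] {X : ∀ x : M, TangentSpace 𝓘(ℝ, E) x} {x₀ : M}
    (hX : SmoothVectorFieldAt X x₀) :
    ContDiffAt ℝ ∞ (chartField x₀ X) (extChartAt 𝓘(ℝ, E) x₀ x₀) := by
  have := contMDiffWithinAt_mpullbackWithin_extChartAt_symm (m := ∞) (n := ∞) (s := Set.univ)
    (x := x₀) (V := X) (I := 𝓘(ℝ, E)) hX.contMDiffWithinAt uniqueMDiffOn_univ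
    (Set.mem_univ _) (by simp)
  rw [contMDiffWithinAt_vectorSpace_iff_contDiffWithinAt] at this
  have := this.contDiffAt (by simpa using! extChartAt_target_mem_nhds (I := 𝓘(ℝ, E)) x₀)
  simpa using! this

theorem SmoothKCovectorAt.contDiffAt_chartForm {α : ∀ x : M, KCovector E k x} {x₀ : M}
    (hα : SmoothKCovectorAt α x₀) :
    ContDiffAt ℝ ∞ (chartForm x₀ α) (extChartAt 𝓘(ℝ, E) x₀ x₀) := by
  have h := SmoothKCovectorAt.pullback (f := (extChartAt 𝓘(ℝ, E) x₀).symm)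
    (x₀ := extChartAt 𝓘(ℝ, E) x₀ x₀) (α := α) (by rwa [extChartAt_to_inv])
    ((contMDiffOn_extChartAt_symm x₀).contMDiffAt (extChartAt_target_mem_nhds x₀))
  unfold SmoothKCovectorAt at h
  rw [contMDiffAt_hom_bundle] at h
  have h2 := h.2.contDiffAt
  refine h2.congr_of_eventuallyEq (.of_forall fun y ↦ ?_)
  ext v
  simp [ContinuousLinearMap.inCoordinates, chartForm]
  rfl

section Related

variable {f : M → N} {x₀ : M} {X Y : ∀ x : M, TangentSpace 𝓘(ℝ, E) x}
  {X' Y' : ∀ y : N, TangentSpace 𝓘(ℝ, F) y}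

theorem contDiffAt_writtenInExtChartAt (hf : ContMDiffAt 𝓘(ℝ, E) 𝓘(ℝ, F) ∞ f x₀) :
    ContDiffAt ℝ ∞ (writtenInExtChartAt 𝓘(ℝ, E) 𝓘(ℝ, F) x₀ f) (extChartAt 𝓘(ℝ, E) x₀ x₀) := by
  simpa [contDiffWithinAt_univ] using! (contMDiffAt_iff.1 hf).2

theorem writtenInExtChartAt_self :
    writtenInExtChartAt 𝓘(ℝ, E) 𝓘(ℝ, F) x₀ f (extChartAt 𝓘(ℝ, E) x₀ x₀) =
      extChartAt 𝓘(ℝ, F) (f x₀) (f x₀) := by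
  simp [writtenInExtChartAt]

theorem fderiv_writtenInExtChartAt_self (hf : ContMDiffAt 𝓘(ℝ, E) 𝓘(ℝ, F) ∞ f x₀) :
    mfderiv 𝓘(ℝ, E) 𝓘(ℝ, F) f x₀ =
      fderiv ℝ (writtenInExtChartAt 𝓘(ℝ, E) 𝓘(ℝ, F) x₀ f) (extChartAt 𝓘(ℝ, E) x₀ x₀) := by
  rw [(hf.mdifferentiableAt (by simp)).mfderiv, modelWithCornersSelf_coe, Set.range_id,
    fderivWithin_univ]

/-- The chain rule for the expression of `f` in charts. -/
theorem eventually_mfderiv_comp_mfderiv_extChartAt_symm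
    (hf : ContMDiffAt 𝓘(ℝ, E) 𝓘(ℝ, F) ∞ f x₀) :
    ∀ᶠ y in 𝓝 (extChartAt 𝓘(ℝ, E) x₀ x₀), y ∈ (extChartAt 𝓘(ℝ, E) x₀).target ∧
      f ((extChartAt 𝓘(ℝ, E) x₀).symm y) ∈ (extChartAt 𝓘(ℝ, F) (f x₀)).source ∧
      ∀ v : E, mfderiv 𝓘(ℝ, E) 𝓘(ℝ, F) f ((extChartAt 𝓘(ℝ, E) x₀).symm y)
        (mfderiv 𝓘(ℝ, E) 𝓘(ℝ, E) (extChartAt 𝓘(ℝ, E) x₀).symm y v) =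
      mfderiv 𝓘(ℝ, F) 𝓘(ℝ, F) (extChartAt 𝓘(ℝ, F) (f x₀)).symm
        (writtenInExtChartAt 𝓘(ℝ, E) 𝓘(ℝ, F) x₀ f y)
        (fderiv ℝ (writtenInExtChartAt 𝓘(ℝ, E) 𝓘(ℝ, F) x₀ f) y v) := by
  have : IsManifold 𝓘(ℝ, E) 1 M := .of_le (n := ∞) (by simp)
  have : IsManifold 𝓘(ℝ, F) 1 N := .of_le (n := ∞) (by simp)
  set φ := extChartAt 𝓘(ℝ, E) x₀
  set ψ := extChartAt 𝓘(ℝ, F) (f x₀)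
  set g := writtenInExtChartAt 𝓘(ℝ, E) 𝓘(ℝ, F) x₀ f with hg
  have hsymm : ContinuousAt φ.symm (φ x₀) := continuousAt_extChartAt_symm x₀
  have hφ₀ : φ.symm (φ x₀) = x₀ := extChartAt_to_inv x₀
  have h₁ : ∀ᶠ x in 𝓝 x₀, f x ∈ ψ.source :=
    hf.continuousAt (extChartAt_source_mem_nhds (f x₀))
  have h₂ : ∀ᶠ x in 𝓝 x₀, MDifferentiableAt 𝓘(ℝ, E) 𝓘(ℝ, F) f x := by
    filter_upwards [(contMDiffAt_iff_contMDiffAt_nhds (by simp)).1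
      (hf.of_le (m := 1) (by simp))] with x hx
    exact hx.mdifferentiableAt one_ne_zero
  have h₃ : ∀ᶠ y in 𝓝 (φ x₀), f (φ.symm y) ∈ ψ.source ∧
      MDifferentiableAt 𝓘(ℝ, E) 𝓘(ℝ, F) f (φ.symm y) := by
    refine hsymm.eventually (p := fun x ↦ f x ∈ ψ.source ∧
      MDifferentiableAt 𝓘(ℝ, E) 𝓘(ℝ, F) f x) ?_
    rw [hφ₀]
    exact h₁.and h₂
  filter_upwards [h₃.eventually_nhds, extChartAt_target_mem_nhds (I := 𝓘(ℝ, E)) x₀,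
    (contDiffAt_writtenInExtChartAt hf).of_le (m := 1) (by simp) |>.eventually (by simp)]
    with y hy hyφ hgy
  refine ⟨hyφ, hy.self_of_nhds.1, fun v ↦ ?_⟩
  have hgd : MDifferentiableAt 𝓘(ℝ, E) 𝓘(ℝ, F) g y :=
    (hgy.differentiableAt one_ne_zero).mdifferentiableAt
  have hgt : g y ∈ ψ.target := ψ.map_source hy.self_of_nhds.1
  have hψd : MDifferentiableAt 𝓘(ℝ, F) 𝓘(ℝ, F) ψ.symm (g y) := by
    have h := mdifferentiableWithinAt_extChartAt_symm (I := 𝓘(ℝ, F)) hgt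
    rwa [modelWithCornersSelf_coe, Set.range_id, mdifferentiableWithinAt_univ] at h
  have hφd : MDifferentiableAt 𝓘(ℝ, E) 𝓘(ℝ, E) φ.symm y := by
    have h := mdifferentiableWithinAt_extChartAt_symm (I := 𝓘(ℝ, E)) hyφ
    rwa [modelWithCornersSelf_coe, Set.range_id, mdifferentiableWithinAt_univ] at h
  have heq : f ∘ φ.symm =ᶠ[𝓝 y] ψ.symm ∘ g := by
    filter_upwards [hy] with z hz
    exact (ψ.left_inv hz.1).symm
  have h₄ := mfderiv_comp_apply y hy.self_of_nhds.2 hφd v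
  have h₅ := mfderiv_comp_apply y hψd hgd v
  rw [mfderiv_eq_fderiv] at h₅
  have h₆ := heq.mfderiv_eq (I := 𝓘(ℝ, E)) (I' := 𝓘(ℝ, F))
  exact h₄.symm.trans ((congrArg (fun T : E →L[ℝ] F ↦ T v) h₆).trans h₅)

/-- Related vector fields have related expressions in charts. -/
theorem eventually_chartField_related (hf : ContMDiffAt 𝓘(ℝ, E) 𝓘(ℝ, F) ∞ f x₀)
    (h : ∀ᶠ x in 𝓝 x₀, mfderiv 𝓘(ℝ, E) 𝓘(ℝ, F) f x (X x) = X' (f x)) :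
    ∀ᶠ y in 𝓝 (extChartAt 𝓘(ℝ, E) x₀ x₀),
      fderiv ℝ (writtenInExtChartAt 𝓘(ℝ, E) 𝓘(ℝ, F) x₀ f) y (chartField x₀ X y) =
        chartField (f x₀) X' (writtenInExtChartAt 𝓘(ℝ, E) 𝓘(ℝ, F) x₀ f y) := by
  have hsymm : ContinuousAt (extChartAt 𝓘(ℝ, E) x₀).symm (extChartAt 𝓘(ℝ, E) x₀ x₀) :=
    continuousAt_extChartAt_symm x₀
  have h' := hsymm.eventually (by rwa [extChartAt_to_inv])
  filter_upwards [eventually_mfderiv_comp_mfderiv_extChartAt_symm hf, h'] with y ⟨hy, hfy, hv⟩ hX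
  have hgy := (extChartAt 𝓘(ℝ, F) (f x₀)).map_source hfy
  apply (isInvertible_mfderiv_extChartAt_symm (f x₀) hgy).injective
  refine (hv _).symm.trans ?_
  have h₁ := mfderiv_extChartAt_symm_chartField x₀ X hy
  have h₂ := mfderiv_extChartAt_symm_chartField (f x₀) X' hgy
  have h₃ := (extChartAt 𝓘(ℝ, F) (f x₀)).left_inv hfy
  rw [h₃] at h₂
  exact (congrArg _ h₁).trans (hX.trans h₂.symm)

theorem eventually_chartForm_pullback {α' : ∀ y : N, KCovector F k y}
    (hf : ContMDiffAt 𝓘(ℝ, E) 𝓘(ℝ, F) ∞ f x₀) :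
    ∀ᶠ y in 𝓝 (extChartAt 𝓘(ℝ, E) x₀ x₀),
      chartForm x₀ (fun x ↦ (α' (f x)).comp (mfderiv 𝓘(ℝ, E) 𝓘(ℝ, F) f x)) y =
        (chartForm (f x₀) α' (writtenInExtChartAt 𝓘(ℝ, E) 𝓘(ℝ, F) x₀ f y)).comp
          (fderiv ℝ (writtenInExtChartAt 𝓘(ℝ, E) 𝓘(ℝ, F) x₀ f) y) := by
  filter_upwards [eventually_mfderiv_comp_mfderiv_extChartAt_symm hf] with y ⟨hy, hfy, hv⟩
  have h₃ := (extChartAt 𝓘(ℝ, F) (f x₀)).left_inv hfy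
  ext v i
  have h₁ := hv v
  -- The fibre of `α'` depends on the base point, so the equality of points is used by substitution
  -- in a statement quantified over both. The same device recurs below.
  have h₂ : ∀ (q q' : N) (_ : q = q') (w : F), (α' q : F →L[ℝ] (Fin k → ℝ)) w = α' q' w := by
    rintro q _ rfl w
    rfl
  exact congrFun ((congrArg _ h₁).trans (h₂ _ _ h₃.symm _)) i

variable [CompleteSpace E] [CompleteSpace F]

/-- The Lie brackets of `f`-related vector fields are `f`-related. -/
theorem mfderiv_mlieBracket_of_related (hf : ContMDiffAt 𝓘(ℝ, E) 𝓘(ℝ, F) ∞ f x₀)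
    (hX : SmoothVectorFieldAt X x₀) (hY : SmoothVectorFieldAt Y x₀)
    (hX' : SmoothVectorFieldAt X' (f x₀)) (hY' : SmoothVectorFieldAt Y' (f x₀))
    (h : ∀ᶠ x in 𝓝 x₀, mfderiv 𝓘(ℝ, E) 𝓘(ℝ, F) f x (X x) = X' (f x))
    (h' : ∀ᶠ x in 𝓝 x₀, mfderiv 𝓘(ℝ, E) 𝓘(ℝ, F) f x (Y x) = Y' (f x)) :
    mfderiv 𝓘(ℝ, E) 𝓘(ℝ, F) f x₀ (mlieBracket 𝓘(ℝ, E) X Y x₀) =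
      mlieBracket 𝓘(ℝ, F) X' Y' (f x₀) := by
  rw [mlieBracket_eq_lieBracket_chartField, mlieBracket_eq_lieBracket_chartField,
    fderiv_writtenInExtChartAt_self hf]
  have hs := writtenInExtChartAt_self (E := E) (F := F) (f := f) (x₀ := x₀)
  have := fderiv_lieBracket_of_related
    ((contDiffAt_writtenInExtChartAt hf).of_le (m := 2) (WithTop.coe_le_coe.2 le_top))
    (hX.contDiffAt_chartField.differentiableAt (by simp))
    (hY.contDiffAt_chartField.differentiableAt (by simp))
    (by rw [hs]; exact hX'.contDiffAt_chartField.differentiableAt (by simp))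
    (by rw [hs]; exact hY'.contDiffAt_chartField.differentiableAt (by simp))
    (eventually_chartField_related hf h) (eventually_chartField_related hf h')
  rw [hs] at this
  exact this

/-- The Lie derivative is natural for `f`-related vector fields. -/
theorem lieDerivAt_pullback {α' : ∀ y : N, KCovector F k y}
    (hf : ContMDiffAt 𝓘(ℝ, E) 𝓘(ℝ, F) ∞ f x₀)
    (hX : SmoothVectorFieldAt X x₀) (hX' : SmoothVectorFieldAt X' (f x₀))
    (hα' : SmoothKCovectorAt α' (f x₀))
    (h : ∀ᶠ x in 𝓝 x₀, mfderiv 𝓘(ℝ, E) 𝓘(ℝ, F) f x (X x) = X' (f x)) :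
    lieDerivAt X (fun x ↦ (α' (f x)).comp (mfderiv 𝓘(ℝ, E) 𝓘(ℝ, F) f x)) x₀ =
      (lieDerivAt X' α' (f x₀)).comp (mfderiv 𝓘(ℝ, E) 𝓘(ℝ, F) f x₀) := by
  rw [lieDerivAt_eq_lieDerivForm, lieDerivAt_eq_lieDerivForm, fderiv_writtenInExtChartAt_self hf]
  have hs := writtenInExtChartAt_self (E := E) (F := F) (f := f) (x₀ := x₀)
  have := lieDerivForm_of_related
    ((contDiffAt_writtenInExtChartAt hf).of_le (m := 2) (WithTop.coe_le_coe.2 le_top))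
    (hX.contDiffAt_chartField.differentiableAt (by simp))
    (by rw [hs]; exact hX'.contDiffAt_chartField.differentiableAt (by simp))
    (by rw [hs]; exact hα'.contDiffAt_chartForm.differentiableAt (by simp))
    (eventually_chartField_related hf h) (eventually_chartForm_pullback (α' := α') hf)
  rw [hs] at this
  exact this

end Related

section Formula

variable [CompleteSpace E] {x₀ : M} {X Z : ∀ x : M, TangentSpace 𝓘(ℝ, E) x}
  {α : ∀ x : M, KCovector E k x}

theorem SmoothKCovectorAt.mdifferentiableAt_apply (hα : SmoothKCovectorAt α x₀)
    (hZ : SmoothVectorFieldAt Z x₀) :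
    MDifferentiableAt 𝓘(ℝ, E) 𝓘(ℝ, Fin k → ℝ) (fun y ↦ α y (Z y)) x₀ := by
  have := ContMDiffAt.clm_bundle_apply (F₂ := Fin k → ℝ) (E₂ := fun _ : M ↦ (Fin k → ℝ)) hα hZ
  rw [contMDiffAt_totalSpace] at this
  exact this.2.mdifferentiableAt (by simp)

/-- `(𝓛_X α)(Z) = X (α(Z)) - α([X, Z])`. -/
theorem lieDerivAt_apply (hα : SmoothKCovectorAt α x₀) (hZ : SmoothVectorFieldAt Z x₀) :
    lieDerivAt X α x₀ (Z x₀) = mvfderiv 𝓘(ℝ, E) (fun y ↦ α y (Z y)) x₀ (X x₀) -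
      α x₀ (mlieBracket 𝓘(ℝ, E) X Z x₀) := by
  have h := lieDerivForm_apply (X := chartField x₀ X)
    (hα.contDiffAt_chartForm.differentiableAt (by simp))
    (hZ.contDiffAt_chartField.differentiableAt (by simp))
  rw [chartField_self, chartField_self, chartForm_self] at h
  rw [lieDerivAt_eq_lieDerivForm, mlieBracket_eq_lieBracket_chartField]
  refine h.trans ?_
  rw [(hα.mdifferentiableAt_apply hZ).mvfderiv]
  congr 2
  simp only [modelWithCornersSelf_coe, Set.range_id]
  rw [fderivWithin_univ]
  apply Filter.EventuallyEq.fderiv_eq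
  filter_upwards [extChartAt_target_mem_nhds (I := 𝓘(ℝ, E)) x₀] with y hy
  have := mfderiv_extChartAt_symm_chartField x₀ Z hy
  exact congrArg (α _) this

end Formula

end Charts

/-! ### Closedness of Ω as a formula for Ω♭ of a bracket. -/

section Closed

variable {E : Type*} [NormedAddCommGroup E] [NormedSpace ℝ E] [FiniteDimensional ℝ E] {k : ℕ}
  {M : Type*} [TopologicalSpace M] [ChartedSpace E M] [IsManifold 𝓘(ℝ, E) ∞ M]

/-- Every tangent vector extends to a global smooth vector field. -/
theorem exists_smoothVectorFieldOn_univ_apply_eq [T2Space M] (x₀ : M)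
    (v : TangentSpace 𝓘(ℝ, E) x₀) :
    ∃ Z : ∀ x : M, TangentSpace 𝓘(ℝ, E) x, SmoothVectorFieldOn Z Set.univ ∧ Z x₀ = v := by
  have ⟨ρ⟩ : Nonempty (SmoothBumpFunction 𝓘(ℝ, E) x₀) := inferInstance
  set e := trivializationAt E (fun x : M ↦ TangentSpace 𝓘(ℝ, E) x) x₀
  have hx₀ : x₀ ∈ e.baseSet := mem_baseSet_trivializationAt E _ x₀
  -- The extension has constant coefficients in the trivialisation at `x₀` and is cut off by a bump
  -- function equal to 1 at `x₀`.
  refine ⟨fun x ↦ ρ x • e.symm x (e ⟨x₀, v⟩).2, ?_, ?_⟩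
  · rw [smoothVectorFieldOn_iff isOpen_univ]
    intro x _
    by_cases hx : x ∈ tsupport ρ
    · have hxe : x ∈ e.baseSet := ρ.tsupport_subset_chartAt_source hx
      refine ContMDiffAt.smul_section ρ.contMDiffAt ?_
      have h₁ : ContMDiffAt 𝓘(ℝ, E) (𝓘(ℝ, E).prod 𝓘(ℝ, E)) ∞ (fun y : M ↦ (y, (e ⟨x₀, v⟩).2)) x :=
        contMDiffAt_id.prodMk contMDiffAt_const
      have h₂ : ContMDiffAt (𝓘(ℝ, E).prod 𝓘(ℝ, E)) (𝓘(ℝ, E).prod 𝓘(ℝ, E)) ∞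
          e.toOpenPartialHomeomorph.symm (x, (e ⟨x₀, v⟩).2) :=
        (e.contMDiffOn_symm).contMDiffAt (e.open_target.mem_nhds (by simpa [e.mem_target] using hxe))
      refine (h₂.comp x h₁).congr_of_eventuallyEq ?_
      filter_upwards [e.open_baseSet.mem_nhds hxe] with y hy
      exact e.mk_symm hy _
    · have h0 : SmoothVectorFieldAt (fun y : M ↦ (0 : TangentSpace 𝓘(ℝ, E) y)) x :=
        (contMDiff_zeroSection ℝ (fun y : M ↦ TangentSpace 𝓘(ℝ, E) y)).contMDiffAt
      refine h0.congr ?_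
      filter_upwards [(isClosed_tsupport ρ).isOpen_compl.mem_nhds hx] with y hy
      rw [image_eq_zero_of_notMem_tsupport hy, zero_smul]
  · simp only [ρ.eq_one, one_smul]
    exact e.symm_apply_apply_mk hx₀ v

namespace PolysymplecticStructure

variable (Ω : PolysymplecticStructure E k M)

theorem apply_swap (x : M) (u v : TangentSpace 𝓘(ℝ, E) x) :
    Ω.toFun x u v = -Ω.toFun x v u := by
  have h := Ω.alternating x (u + v)
  simp only [map_add, add_apply, Ω.alternating, zero_add, add_zero] at h
  exact eq_neg_of_add_eq_zero_right h

theorem smoothKCovectorAt_flat {X : ∀ x : M, TangentSpace 𝓘(ℝ, E) x} {x₀ : M}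
    (hX : SmoothVectorFieldAt X x₀) : SmoothKCovectorAt (fun x ↦ Ω.flat x (X x)) x₀ :=
  ContMDiffAt.clm_bundle_apply (F₂ := E →L[ℝ] (Fin k → ℝ))
    (E₂ := fun x : M ↦ TangentSpace 𝓘(ℝ, E) x →L[ℝ] (Fin k → ℝ)) (Ω.smooth x₀) hX

/-- `i_{[X, Y]} Ω = 𝓛_X i_Y Ω - 𝓛_Y i_X Ω - d(Ω(Y, X))`. -/
theorem flat_mlieBracket [T2Space M] {X Y : ∀ x : M, TangentSpace 𝓘(ℝ, E) x}
    (hX : SmoothVectorFieldOn X Set.univ) (hY : SmoothVectorFieldOn Y Set.univ) (x : M) :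
    Ω.flat x (mlieBracket 𝓘(ℝ, E) X Y x) =
      lieDerivAt X (fun y ↦ Ω.flat y (Y y)) x - lieDerivAt Y (fun y ↦ Ω.flat y (X y)) x -
        mvfderiv 𝓘(ℝ, E) (fun y ↦ Ω.flat y (Y y) (X y)) x := by
  have : CompleteSpace E := FiniteDimensional.complete ℝ E
  ext1 v
  -- Closedness is stated for global fields, so the test vector is extended globally. Expanding both
  -- Lie derivatives against `Z` reproduces the six terms of dΩ(X, Y, Z).
  obtain ⟨Z, hZ, rfl⟩ := exists_smoothVectorFieldOn_univ_apply_eq x v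
  have hcl := Ω.closed X Y Z hX hY hZ x
  rw [smoothVectorFieldOn_iff isOpen_univ] at hX hY hZ
  replace hX := hX x (Set.mem_univ x)
  replace hY := hY x (Set.mem_univ x)
  replace hZ := hZ x (Set.mem_univ x)
  have h₁ := lieDerivAt_apply (X := X) (Ω.smoothKCovectorAt_flat hY) hZ
  have h₂ := lieDerivAt_apply (X := Y) (Ω.smoothKCovectorAt_flat hX) hZ
  have h₃ : mvfderiv 𝓘(ℝ, E) (fun y ↦ Ω.toFun y (X y) (Y y)) x =
      -mvfderiv 𝓘(ℝ, E) (fun y ↦ Ω.toFun y (Y y) (X y)) x := by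
    rw [← mvfderiv_fun_neg]
    congr 1
    funext y
    exact Ω.apply_swap y _ _
  rw [h₃, Ω.apply_swap x _ (Y x), Ω.apply_swap x (mlieBracket 𝓘(ℝ, E) Y Z x) (X x)] at hcl
  change Ω.toFun x (mlieBracket 𝓘(ℝ, E) X Y x) (Z x) = lieDerivAt X _ x (Z x) -
    lieDerivAt Y _ x (Z x) - mvfderiv 𝓘(ℝ, E) (fun y ↦ Ω.toFun y (Y y) (X y)) x (Z x)
  rw [h₁, h₂]
  change _ = (mvfderiv 𝓘(ℝ, E) (fun y ↦ Ω.toFun y (Y y) (Z y)) x (X x) -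
    Ω.toFun x (Y x) (mlieBracket 𝓘(ℝ, E) X Z x)) -
    (mvfderiv 𝓘(ℝ, E) (fun y ↦ Ω.toFun y (X y) (Z y)) x (Y x) -
    Ω.toFun x (X x) (mlieBracket 𝓘(ℝ, E) Y Z x)) - _
  rw [neg_apply] at hcl
  rw [← sub_eq_zero, ← neg_eq_zero, ← hcl]
  abel

end PolysymplecticStructure

end Closed

end PolyPoisson

/-! ### Local sections of submersions and covectors pulled back from the orbit space. -/

/-- A submersion has smooth local sections through every point. -/
theorem Manifold.IsSubmersion.exists_local_section {E F M N : Type*} [NormedAddCommGroup E]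
    [NormedSpace ℝ E] [NormedAddCommGroup F] [NormedSpace ℝ F]
    [TopologicalSpace M] [ChartedSpace E M] [TopologicalSpace N] [ChartedSpace F N] {f : M → N}
    (hf : Manifold.IsSubmersion 𝓘(ℝ, E) 𝓘(ℝ, F) ∞ f) (p : M) :
    ∃ (V : Set N) (s : N → M), IsOpen V ∧ f p ∈ V ∧ ContMDiffOn 𝓘(ℝ, F) 𝓘(ℝ, E) ∞ s V ∧
      s (f p) = p ∧ ∀ q ∈ V, f (s q) = q := by
  have h := hf.isSubmersionAt p
  set φ := h.domChart
  set ψ := h.codChart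
  set L := h.equiv
  have hp : p ∈ φ.source := h.mem_domChart_source
  have hfp : f p ∈ ψ.source := h.mem_codChart_source
  have hw : ∀ y ∈ φ.target, ψ (f (φ.symm y)) = (L y).1 := fun y hy ↦ by
    have h₁ := h.writtenInCharts (show y ∈ (φ.extend 𝓘(ℝ, E)).target by simpa using hy)
    simpa using! h₁
  have hsub : ∀ x ∈ φ.source, f x ∈ ψ.source := fun x hx ↦ h.source_subset_preimage_source hx
  -- In adapted charts f is the first projection; the section freezes the second coordinate at its
  -- value at `p`.
  let w := (L (φ p)).2
  let j : N → E := fun q ↦ L.symm (ψ q, w)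
  have hj : ContMDiffOn 𝓘(ℝ, F) 𝓘(ℝ, E) ∞ j ψ.source :=
    L.symm.contDiff.contMDiff.comp_contMDiffOn
      ((contMDiffOn_of_mem_maximalAtlas h.codChart_mem_maximalAtlas).prodMk_space contMDiffOn_const)
  have hjp : j (f p) = φ p := by
    have := hw (φ p) (φ.map_source hp)
    rw [φ.left_inv hp] at this
    simp only [j, w, this]
    exact L.symm_apply_apply _
  refine ⟨ψ.source ∩ j ⁻¹' φ.target, fun q ↦ φ.symm (j q),
    hj.continuousOn.isOpen_inter_preimage ψ.open_source φ.open_target,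
    ⟨hfp, by simpa [hjp] using φ.map_source hp⟩, ?_, by simp [hjp, hp], ?_⟩
  · exact (contMDiffOn_symm_of_mem_maximalAtlas h.domChart_mem_maximalAtlas).comp
      (hj.mono Set.inter_subset_left) fun q hq ↦ hq.2
  · rintro q ⟨hq, hq'⟩
    apply ψ.injOn (hsub _ (φ.map_target hq')) hq
    rw [hw _ hq']
    simp [j]

namespace PolyPoisson

section Reduction

variable {E : Type*} [NormedAddCommGroup E] [NormedSpace ℝ E] {k : ℕ}
  {M : Type*} {G : Type*} [Group G] [MulAction G M]

theorem proj_surjective : Function.Surjective (proj (M := M) G) := Quotient.mk_surjective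

theorem proj_smul (g : G) (p : M) : proj G (g • p) = proj G p :=
  Quotient.sound ⟨g, rfl⟩

theorem proj_eq_iff {p p' : M} : proj G p = proj G p' ↔ ∃ g : G, g • p = p' := by
  rw [eq_comm]
  exact Quotient.eq.trans Iff.rfl

variable [TopologicalSpace M] [ChartedSpace E M]

variable {F : Type*} [NormedAddCommGroup F] [NormedSpace ℝ F]
  [ChartedSpace F (MulAction.orbitRel.Quotient G M)]

/-- The pullback `α ↦ α ∘ T_pπ` of `k`-covectors at any point of `M / G`, in terms of the model
space. -/
def pullAt (G : Type*) [Group G] [MulAction G M]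
    (F : Type*) [NormedAddCommGroup F] [NormedSpace ℝ F]
    [ChartedSpace F (MulAction.orbitRel.Quotient G M)] (p : M) :
    (F →L[ℝ] (Fin k → ℝ)) →ₗ[ℝ] KCovector E k p :=
  pullProj G F p

theorem pullAt_apply (p : M) (a : F →L[ℝ] (Fin k → ℝ)) (v : TangentSpace 𝓘(ℝ, E) p) :
    pullAt G F p a v = a (tangentProj G F p v) := rfl

theorem pullAt_injective {p : M} (h : Function.Surjective (tangentProj (E := E) G F p)) :
    Function.Injective (pullAt (E := E) (k := k) G F p) := by
  intro a b hab
  ext v : 1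
  obtain ⟨u, rfl⟩ := h v
  exact DFunLike.congr_fun hab u

theorem pullAt_mem_annihilator (p : M) (a : F →L[ℝ] (Fin k → ℝ)) :
    pullAt (E := E) G F p a ∈ annihilator k (vertical G F p) := by
  intro v hv A
  have hv' : tangentProj G F p v = 0 := hv
  rw [pullAt_apply, hv']
  exact congrFun (map_zero a) A

theorem exists_pullAt_eq [FiniteDimensional ℝ F] {p : M}
    (h : Function.Surjective (tangentProj (E := E) G F p))
    {b : KCovector E k p} (hb : b ∈ annihilator k (vertical G F p)) :
    ∃ a : F →L[ℝ] (Fin k → ℝ), pullAt G F p a = b := by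
  let T : E →L[ℝ] F := tangentProj (E := E) G F p
  obtain ⟨R, hR⟩ := T.exists_rightInverse_of_surjective (LinearMap.range_eq_top.2 h)
  refine ⟨ContinuousLinearMap.comp b R, ?_⟩
  ext (v : E) A
  -- `b ∘ R` pulls back to `b` because R(Tv) and v differ by a vertical vector, which `b` kills.
  have hv : R (T v) - v ∈ vertical (E := E) G F p := by
    change T (R (T v) - v) = 0
    rw [map_sub, sub_eq_zero]
    exact DFunLike.congr_fun hR (T v)
  have h₁ := hb _ hv A
  have h₂ : b (R (T v) - v) = b (R (T v)) - b v := map_sub (b : E →L[ℝ] (Fin k → ℝ)) _ _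
  rw [h₂] at h₁
  exact sub_eq_zero.1 h₁

theorem tangentProj_comp_section
    (hπ : Manifold.IsSubmersion 𝓘(ℝ, E) 𝓘(ℝ, F) ∞ (proj (M := M) G))
    {V : Set (MulAction.orbitRel.Quotient G M)} {s : MulAction.orbitRel.Quotient G M → M}
    (hV : IsOpen V) (hs : ContMDiffOn 𝓘(ℝ, F) 𝓘(ℝ, E) ∞ s V) (hsec : ∀ q ∈ V, proj G (s q) = q)
    {q : MulAction.orbitRel.Quotient G M} (hq : q ∈ V) (v : F) :
    tangentProj (E := E) G F (s q) (mfderiv 𝓘(ℝ, F) 𝓘(ℝ, E) s q v) = v := by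
  have h₁ : MDifferentiableAt 𝓘(ℝ, F) 𝓘(ℝ, E) s q :=
    (hs.contMDiffAt (hV.mem_nhds hq)).mdifferentiableAt (by simp)
  have h₂ : MDifferentiableAt 𝓘(ℝ, E) 𝓘(ℝ, F) (proj (M := M) G) (s q) :=
    hπ.contMDiff.mdifferentiable (by simp) _
  have h₃ := mfderiv_comp q h₂ h₁
  have h₄ : proj G ∘ s =ᶠ[𝓝 q] id := Filter.eventually_of_mem (hV.mem_nhds hq) hsec
  have h₅ : (mfderiv 𝓘(ℝ, F) 𝓘(ℝ, F) (proj G ∘ s) q : F →L[ℝ] F) =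
    ContinuousLinearMap.id ℝ F := h₄.mfderiv_eq.trans mfderiv_id
  exact (DFunLike.congr_fun h₃ v).symm.trans (DFunLike.congr_fun h₅ v)

/-- A local section through `p` gives a right inverse of T_pπ by the chain rule. -/
theorem tangentProj_surjective
    (hπ : Manifold.IsSubmersion 𝓘(ℝ, E) 𝓘(ℝ, F) ∞ (proj (M := M) G)) (p : M) :
    Function.Surjective (tangentProj (E := E) G F p) := by
  obtain ⟨V, s, hV, hpV, hs, hsp, hsec⟩ := hπ.exists_local_section p
  have h : Function.Surjective (tangentProj (E := E) G F (s (proj G p))) := fun v ↦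
    ⟨_, tangentProj_comp_section hπ hV hs hsec hpV v⟩
  rwa [hsp] at h

section Action

theorem tangentProj_smul (hΦ : ∀ g : G, ContMDiff 𝓘(ℝ, E) 𝓘(ℝ, E) ∞ (fun x : M ↦ g • x))
    (hπ : ContMDiff 𝓘(ℝ, E) 𝓘(ℝ, F) ∞ (proj (M := M) G)) (g : G) (p : M) (v : E) :
    (tangentProj (E := E) G F (g • p)
      (mfderiv 𝓘(ℝ, E) 𝓘(ℝ, E) (fun x : M ↦ g • x) p v) : F) = tangentProj (E := E) G F p v := by
  have h₁ := mfderiv_comp p (hπ.mdifferentiable (by simp) (g • p))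
    ((hΦ g).mdifferentiable (by simp) p)
  have h₂ : proj G ∘ (fun x : M ↦ g • x) = proj G := funext fun x ↦ proj_smul g x
  have h₃ : ∀ f : M → MulAction.orbitRel.Quotient G M, f = proj G →
      (mfderiv 𝓘(ℝ, E) 𝓘(ℝ, F) f p : E →L[ℝ] F) = tangentProj (E := E) G F p := by
    rintro _ rfl
    rfl
  exact (DFunLike.congr_fun h₁ v).symm.trans (DFunLike.congr_fun (h₃ (proj G ∘ fun x : M ↦ g • x) h₂) v)

theorem mfderiv_smul_surjective
    (hΦ : ∀ g : G, ContMDiff 𝓘(ℝ, E) 𝓘(ℝ, E) ∞ (fun x : M ↦ g • x)) (g : G) (p : M) :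
    Function.Surjective (mfderiv 𝓘(ℝ, E) 𝓘(ℝ, E) (fun x : M ↦ g • x) p) := by
  have h₁ := mfderiv_comp (g • p) (I' := 𝓘(ℝ, E)) (g := fun x : M ↦ g • x)
    (f := fun x : M ↦ g⁻¹ • x)
    ((hΦ g).mdifferentiable (by simp) _) ((hΦ g⁻¹).mdifferentiable (by simp) _)
  have h₂ : (fun x : M ↦ g • x) ∘ (fun x : M ↦ g⁻¹ • x) = id := funext fun x ↦ smul_inv_smul g x
  have h₃ : ∀ f : M → M, f = id →
      (mfderiv 𝓘(ℝ, E) 𝓘(ℝ, E) f (g • p) : E →L[ℝ] E) = ContinuousLinearMap.id ℝ E := by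
    rintro _ rfl
    exact mfderiv_id
  rw [inv_smul_smul] at h₁
  intro v
  exact ⟨_, (DFunLike.congr_fun h₁ v).symm.trans (DFunLike.congr_fun (h₃ _ h₂) v)⟩

variable [IsManifold 𝓘(ℝ, E) ∞ M]

/-- The equation `Ω♭ X = a ∘ T_pπ` is invariant along orbits. -/
theorem exists_flat_eq_pullAt_of_proj_eq
    (hΦ : ∀ g : G, ContMDiff 𝓘(ℝ, E) 𝓘(ℝ, E) ∞ (fun x : M ↦ g • x))
    (hπ : ContMDiff 𝓘(ℝ, E) 𝓘(ℝ, F) ∞ (proj (M := M) G))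
    {Ω : PolysymplecticStructure E k M} (hinv : IsInvariant G Ω) {p p' : M}
    (hpp' : proj G p = proj G p') {a : F →L[ℝ] (Fin k → ℝ)} {X : TangentSpace 𝓘(ℝ, E) p}
    (hX : Ω.flat p X = pullAt G F p a) :
    ∃ X' : TangentSpace 𝓘(ℝ, E) p', Ω.flat p' X' = pullAt G F p' a ∧
      (tangentProj G F p' X' : F) = tangentProj G F p X := by
  obtain ⟨g, rfl⟩ := proj_eq_iff.1 hpp'
  refine ⟨mfderiv 𝓘(ℝ, E) 𝓘(ℝ, E) (fun x : M ↦ g • x) p X, ?_, tangentProj_smul hΦ hπ g p X⟩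
  ext1 w
  obtain ⟨v, rfl⟩ := mfderiv_smul_surjective hΦ g p w
  refine (hinv g p X v).trans ((DFunLike.congr_fun hX v).trans ?_)
  exact congrArg a (tangentProj_smul hΦ hπ g p v).symm

end Action

end Reduction

end PolyPoisson

/-! ### The reduced bundle and the reduced morphism. -/

namespace PolyPoisson

open VectorField

section ReducedStructure

variable {E : Type*} [NormedAddCommGroup E] [NormedSpace ℝ E] {k : ℕ}
  {M : Type*} [TopologicalSpace M] [ChartedSpace E M] [IsManifold 𝓘(ℝ, E) ∞ M]
  {G : Type*} [Group G] [MulAction G M]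
  {F : Type*} [NormedAddCommGroup F] [NormedSpace ℝ F]
  [ChartedSpace F (MulAction.orbitRel.Quotient G M)]
  (Ω : PolysymplecticStructure E k M)

/-- The reduced family of subspaces, computed at a representative of each orbit. -/
def reducedSubspace (q : MulAction.orbitRel.Quotient G M) : Submodule ℝ (KCovector F k q) :=
  Submodule.comap (pullAt (E := E) G F (Quotient.out q)) (Ω.image (Quotient.out q))

variable {Ω}

theorem proj_out (q : MulAction.orbitRel.Quotient G M) : proj G (Quotient.out q : M) = q :=
  Quotient.out_eq q

/-- Frees the definition from the chosen representative: the equation Ω♭X = π^*α is transported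
along the orbit by invariance of Ω. -/
theorem mem_reducedSubspace_iff
    (hΦ : ∀ g : G, ContMDiff 𝓘(ℝ, E) 𝓘(ℝ, E) ∞ (fun x : M ↦ g • x))
    (hπ : ContMDiff 𝓘(ℝ, E) 𝓘(ℝ, F) ∞ (proj (M := M) G)) (hinv : IsInvariant G Ω)
    {q : MulAction.orbitRel.Quotient G M} {p : M} (hp : proj G p = q) {α : KCovector F k q} :
    α ∈ reducedSubspace Ω q ↔ ∃ X, Ω.flat p X = pullAt G F p α := by
  constructor
  · rintro ⟨X, hX⟩
    obtain ⟨X', h, -⟩ := exists_flat_eq_pullAt_of_proj_eq hΦ hπ hinv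
      ((proj_out q).trans hp.symm) hX
    exact ⟨X', h⟩
  · rintro ⟨X, hX⟩
    obtain ⟨X', h, -⟩ := exists_flat_eq_pullAt_of_proj_eq hΦ hπ hinv
      (hp.trans (proj_out q).symm) hX
    exact ⟨X', h⟩

/-- The reduced morphism, computed at a representative of each orbit. -/
def reducedSharp (Ω : PolysymplecticStructure E k M) (q : MulAction.orbitRel.Quotient G M) :
    reducedSubspace (F := F) Ω q →ₗ[ℝ] TangentSpace 𝓘(ℝ, F) q :=
  ((tangentProj G F (Quotient.out q)).toLinearMap :
      TangentSpace 𝓘(ℝ, E) (Quotient.out q) →ₗ[ℝ] F) ∘ₗ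
    (LinearEquiv.ofInjective (Ω.flat (Quotient.out q)) (Ω.flat_injective _)).symm.toLinearMap ∘ₗ
    (pullAt (E := E) G F (Quotient.out q)).restrict (fun _ h ↦ h)

theorem reducedSharp_eq
    (hΦ : ∀ g : G, ContMDiff 𝓘(ℝ, E) 𝓘(ℝ, E) ∞ (fun x : M ↦ g • x))
    (hπ : ContMDiff 𝓘(ℝ, E) 𝓘(ℝ, F) ∞ (proj (M := M) G)) (hinv : IsInvariant G Ω)
    {q : MulAction.orbitRel.Quotient G M} {p : M} (hp : proj G p = q)
    (α : reducedSubspace (F := F) Ω q) {X : TangentSpace 𝓘(ℝ, E) p}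
    (hX : Ω.flat p X = pullAt G F p α.1) :
    (reducedSharp Ω q α : F) = tangentProj G F p X := by
  obtain ⟨X', h, h'⟩ := exists_flat_eq_pullAt_of_proj_eq hΦ hπ hinv
    (hp.trans (proj_out q).symm) hX
  rw [← h']
  refine congrArg (tangentProj (E := E) G F (Quotient.out q)) ?_
  apply Ω.flat_injective
  rw [h]
  exact congrArg Subtype.val ((LinearEquiv.ofInjective (Ω.flat (Quotient.out q))
    (Ω.flat_injective _)).apply_symm_apply _)

section Lift

variable (hΦ : ∀ g : G, ContMDiff 𝓘(ℝ, E) 𝓘(ℝ, E) ∞ (fun x : M ↦ g • x))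
    (hπ : ContMDiff 𝓘(ℝ, E) 𝓘(ℝ, F) ∞ (proj (M := M) G)) (hinv : IsInvariant G Ω)

/-- The vector field `X` on `M` with `Ω♭ X = π^* σ`, for a section `σ` of the reduced bundle. -/
def liftField (σ : ∀ q, reducedSubspace (F := F) (G := G) Ω q) (p : M) : TangentSpace 𝓘(ℝ, E) p :=
  Classical.choose ((mem_reducedSubspace_iff hΦ hπ hinv (p := p) rfl).1 (σ (proj G p)).2)

theorem flat_liftField (σ : ∀ q, reducedSubspace (F := F) (G := G) Ω q) (p : M) :
    Ω.flat p (liftField hΦ hπ hinv σ p) =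
      (σ (proj G p)).1.comp (mfderiv 𝓘(ℝ, E) 𝓘(ℝ, F) (proj (M := M) G) p) :=
  Classical.choose_spec ((mem_reducedSubspace_iff hΦ hπ hinv (p := p) rfl).1 (σ (proj G p)).2)

theorem mfderiv_proj_liftField (σ : ∀ q, reducedSubspace (F := F) (G := G) Ω q) (p : M) :
    mfderiv 𝓘(ℝ, E) 𝓘(ℝ, F) (proj (M := M) G) p (liftField hΦ hπ hinv σ p) =
      reducedSharp Ω (proj G p) (σ (proj G p)) :=
  (reducedSharp_eq hΦ hπ hinv rfl _ (flat_liftField hΦ hπ hinv σ p)).symm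

/-- The lift is chosen point by point, but nondegeneracy leaves no choice: Ω♭ of it is the smooth
form π^*σ, and an injective smooth bundle morphism reflects smoothness. -/
theorem smoothVectorFieldAt_liftField [FiniteDimensional ℝ E]
    [IsManifold 𝓘(ℝ, F) ∞ (MulAction.orbitRel.Quotient G M)]
    {σ : ∀ q, reducedSubspace (F := F) (G := G) Ω q} {p : M}
    (hσ : SmoothKCovectorAt (fun q ↦ (σ q : KCovector F k q)) (proj G p)) :
    SmoothVectorFieldAt (liftField hΦ hπ hinv σ) p := by
  apply Ω.smoothVectorFieldAt_of_flat
  refine (hσ.pullback hπ.contMDiffAt).congr (.of_forall fun x ↦ ?_)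
  exact flat_liftField hΦ hπ hinv σ x

end Lift

/-- All tangent and covector fibres are definitionally the model fibre, so an element can be moved
along an equality of base points without a cast. -/
theorem mk_eq_mk_of_eq {B W : Type*} {q q' : B} (h : q = q') (a : W) :
    (⟨q, a⟩ : TotalSpace W (fun _ : B ↦ W)) = ⟨q', a⟩ := by
  rw [h]

/-- Near π(p) the reduced field is Tπ ∘ X ∘ s, with X the smooth lift of σ and s a local section of
π through p. -/
theorem smoothVectorFieldAt_reducedSharp [FiniteDimensional ℝ E]
    [IsManifold 𝓘(ℝ, F) ∞ (MulAction.orbitRel.Quotient G M)]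
    (hΦ : ∀ g : G, ContMDiff 𝓘(ℝ, E) 𝓘(ℝ, E) ∞ (fun x : M ↦ g • x))
    (hπ : Manifold.IsSubmersion 𝓘(ℝ, E) 𝓘(ℝ, F) ∞ (proj (M := M) G)) (hinv : IsInvariant G Ω)
    {σ : ∀ q, reducedSubspace (F := F) (G := G) Ω q} {q₀ : MulAction.orbitRel.Quotient G M}
    (hσ : SmoothKCovectorAt (fun q ↦ (σ q : KCovector F k q)) q₀) :
    SmoothVectorFieldAt (fun q ↦ reducedSharp Ω q (σ q)) q₀ := by
  obtain ⟨p, rfl⟩ := proj_surjective q₀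
  obtain ⟨V, s, hV, hpV, hs, hsp, hsec⟩ := hπ.exists_local_section p
  have hX := smoothVectorFieldAt_liftField hΦ hπ.contMDiff hinv hσ
  have h₁ : ContMDiffAt 𝓘(ℝ, F) 𝓘(ℝ, E).tangent ∞
      (fun q ↦ (⟨s q, liftField hΦ hπ.contMDiff hinv σ (s q)⟩ : TangentBundle 𝓘(ℝ, E) M))
      (proj G p) := by
    refine ContMDiffAt.comp (g := fun x : M ↦
      (⟨x, liftField hΦ hπ.contMDiff hinv σ x⟩ : TangentBundle 𝓘(ℝ, E) M)) _ ?_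
      (hs.contMDiffAt (hV.mem_nhds hpV))
    rw [hsp]
    exact hX
  have h₂ := ((hπ.contMDiff.contMDiff_tangentMap (m := ∞) (by simp)).contMDiffAt).comp _ h₁
  refine h₂.congr_of_eventuallyEq ?_
  filter_upwards [hV.mem_nhds hpV] with q hq
  have h₃ := reducedSharp_eq hΦ hπ.contMDiff hinv (hsec q hq) (σ q)
    (X := liftField hΦ hπ.contMDiff hinv σ (s q)) ?_
  · change (⟨q, reducedSharp Ω q (σ q)⟩ : TotalSpace F (fun _ ↦ F)) =
      ⟨proj G (s q), tangentProj G F (s q) (liftField hΦ hπ.contMDiff hinv σ (s q))⟩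
    rw [h₃]
    exact mk_eq_mk_of_eq (hsec q hq).symm _
  · have h₄ := flat_liftField hΦ hπ.contMDiff hinv σ (s q)
    rw [h₄]
    have h₅ : ∀ q' : MulAction.orbitRel.Quotient G M, q' = q →
        ((σ q').1 : F →L[ℝ] (Fin k → ℝ)) = (σ q).1 := by
      rintro _ rfl
      rfl
    exact congrArg (fun a : F →L[ℝ] (Fin k → ℝ) ↦ pullAt (E := E) G F (s q) a) (h₅ _ (hsec q hq))

theorem map_pullAt_reducedSubspace [FiniteDimensional ℝ F]
    (hΦ : ∀ g : G, ContMDiff 𝓘(ℝ, E) 𝓘(ℝ, E) ∞ (fun x : M ↦ g • x))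
    (hπ : Manifold.IsSubmersion 𝓘(ℝ, E) 𝓘(ℝ, F) ∞ (proj (M := M) G)) (hinv : IsInvariant G Ω)
    {q : MulAction.orbitRel.Quotient G M} {p : M} (hp : proj G p = q) :
    Submodule.map (pullAt (E := E) (k := k) G F p) (reducedSubspace Ω q) = basicImage G F Ω p := by
  ext b
  constructor
  · rintro ⟨a, ha, rfl⟩
    exact ⟨(mem_reducedSubspace_iff hΦ hπ.contMDiff hinv hp).1 ha, pullAt_mem_annihilator p a⟩
  · rintro ⟨⟨X, hX⟩, hb⟩
    obtain ⟨a, rfl⟩ := exists_pullAt_eq (tangentProj_surjective hπ p) hb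
    exact ⟨a, (mem_reducedSubspace_iff hΦ hπ.contMDiff hinv hp).2 ⟨X, hX⟩, rfl⟩

/-- The pullback by a local section inverts `pullAt` on `k`-covectors vanishing on vertical
vectors. -/
theorem pullAt_comp_section
    (hπ : Manifold.IsSubmersion 𝓘(ℝ, E) 𝓘(ℝ, F) ∞ (proj (M := M) G))
    {V : Set (MulAction.orbitRel.Quotient G M)} {s : MulAction.orbitRel.Quotient G M → M}
    (hV : IsOpen V) (hs : ContMDiffOn 𝓘(ℝ, F) 𝓘(ℝ, E) ∞ s V) (hsec : ∀ q ∈ V, proj G (s q) = q)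
    {q : MulAction.orbitRel.Quotient G M} (hq : q ∈ V) {b : KCovector E k (s q)}
    (hb : b ∈ annihilator k (vertical G F (s q))) :
    pullAt G F (s q) (b.comp (mfderiv 𝓘(ℝ, F) 𝓘(ℝ, E) s q)) = b := by
  ext (v : E) A
  let R : F →L[ℝ] E := mfderiv 𝓘(ℝ, F) 𝓘(ℝ, E) s q
  let T : E →L[ℝ] F := tangentProj (E := E) G F (s q)
  have hv : R (T v) - v ∈ vertical (E := E) G F (s q) := by
    change T (R (T v) - v) = 0
    rw [map_sub, sub_eq_zero]
    exact tangentProj_comp_section hπ hV hs hsec hq (T v)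
  have h₁ := hb _ hv A
  have h₂ : b (R (T v) - v) = b (R (T v)) - b v := map_sub (b : E →L[ℝ] (Fin k → ℝ)) _ _
  rw [h₂] at h₁
  exact sub_eq_zero.1 h₁

theorem comp_section_pullAt
    (hπ : Manifold.IsSubmersion 𝓘(ℝ, E) 𝓘(ℝ, F) ∞ (proj (M := M) G))
    {V : Set (MulAction.orbitRel.Quotient G M)} {s : MulAction.orbitRel.Quotient G M → M}
    (hV : IsOpen V) (hs : ContMDiffOn 𝓘(ℝ, F) 𝓘(ℝ, E) ∞ s V) (hsec : ∀ q ∈ V, proj G (s q) = q)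
    {q : MulAction.orbitRel.Quotient G M} (hq : q ∈ V) (a : KCovector F k q) :
    (pullAt (E := E) G F (s q) a).comp (mfderiv 𝓘(ℝ, F) 𝓘(ℝ, E) s q) = a := by
  ext1 v
  exact congrArg (a : F →L[ℝ] (Fin k → ℝ)) (tangentProj_comp_section hπ hV hs hsec hq v)

/-- A local frame of S ∩ (Vπ)^{∘k} is pulled back along a local section s of π. Because its members
kill vertical vectors, π^* at s(q) restores them, and injectivity of π^* transfers independence and
span. -/
theorem isSubbundle_reducedSubspace [FiniteDimensional ℝ F]
    [IsManifold 𝓘(ℝ, F) ∞ (MulAction.orbitRel.Quotient G M)]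
    (hΦ : ∀ g : G, ContMDiff 𝓘(ℝ, E) 𝓘(ℝ, E) ∞ (fun x : M ↦ g • x))
    (hπ : Manifold.IsSubmersion 𝓘(ℝ, E) 𝓘(ℝ, F) ∞ (proj (M := M) G)) (hinv : IsInvariant G Ω)
    (hS : IsSubbundle (basicImage (E := E) G F Ω)) :
    IsSubbundle (reducedSubspace (F := F) (G := G) Ω) := by
  intro q₀
  obtain ⟨p, rfl⟩ := proj_surjective q₀
  obtain ⟨V, s, hV, hpV, hs, hsp, hsec⟩ := hπ.exists_local_section p
  obtain ⟨U, hU, hpU, r, σ, hσ, hσS⟩ := hS p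
  refine ⟨V ∩ s ⁻¹' U, hs.continuousOn.isOpen_inter_preimage hV hU, ⟨hpV, ?_⟩, r,
    fun i q ↦ (σ i (s q)).comp (mfderiv 𝓘(ℝ, F) 𝓘(ℝ, E) s q), fun i ↦ ?_, fun q hq ↦ ?_⟩
  · rwa [Set.mem_preimage, hsp]
  · rw [smoothKCovectorOn_iff (hs.continuousOn.isOpen_inter_preimage hV hU)]
    intro q hq
    exact ((smoothKCovectorOn_iff hU).1 (hσ i) _ hq.2).pullback
      (hs.contMDiffAt (hV.mem_nhds hq.1))
  · obtain ⟨hli, hspan⟩ := hσS (s q) hq.2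
    have hpull : ∀ i, pullAt G F (s q) ((σ i (s q)).comp (mfderiv 𝓘(ℝ, F) 𝓘(ℝ, E) s q)) =
        σ i (s q) := fun i ↦ by
      have hi : σ i (s q) ∈ basicImage G F Ω (s q) := by
        rw [← hspan]
        exact Submodule.subset_span ⟨i, rfl⟩
      exact pullAt_comp_section hπ hV hs hsec hq.1 hi.2
    have hli' : LinearIndependent ℝ (pullAt (E := E) G F (s q) ∘
        fun i ↦ (σ i (s q)).comp (mfderiv 𝓘(ℝ, F) 𝓘(ℝ, E) s q)) := by
      convert hli using 2 with i
      exact hpull i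
    refine ⟨hli'.of_comp, ?_⟩
    have hinj := pullAt_injective (k := k) (tangentProj_surjective hπ (s q))
    apply Submodule.map_injective_of_injective hinj
    refine Eq.trans ?_ (map_pullAt_reducedSubspace hΦ hπ hinv (hsec q hq.1)).symm
    refine (Submodule.map_span (pullAt (E := E) G F (s q)) _).trans ?_
    refine (congrArg (Submodule.span ℝ) ((Set.range_comp _ _).symm.trans ?_)).trans hspan
    exact congrArg Set.range (funext hpull)

end ReducedStructure

end PolyPoisson

/-! ### The poly-Poisson axioms and uniqueness. -/

namespace PolyPoisson

open VectorField

section ReducedPolyPoisson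

variable {E : Type*} [NormedAddCommGroup E] [NormedSpace ℝ E] [FiniteDimensional ℝ E] {k : ℕ}
  {M : Type*} [TopologicalSpace M] [ChartedSpace E M] [IsManifold 𝓘(ℝ, E) ∞ M]
  {G : Type*} [Group G] [MulAction G M]
  {F : Type*} [NormedAddCommGroup F] [NormedSpace ℝ F] [FiniteDimensional ℝ F]
  [ChartedSpace F (MulAction.orbitRel.Quotient G M)]
  {Ω : PolysymplecticStructure E k M}

theorem reducedSharp_skew
    (hΦ : ∀ g : G, ContMDiff 𝓘(ℝ, E) 𝓘(ℝ, E) ∞ (fun x : M ↦ g • x))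
    (hπ : ContMDiff 𝓘(ℝ, E) 𝓘(ℝ, F) ∞ (proj (M := M) G)) (hinv : IsInvariant G Ω)
    (q : MulAction.orbitRel.Quotient G M) (α : reducedSubspace (F := F) Ω q) :
    (α : KCovector F k q) (reducedSharp Ω q α) = 0 := by
  obtain ⟨p, hp⟩ := proj_surjective q
  obtain ⟨X, hX⟩ := (mem_reducedSubspace_iff hΦ hπ hinv hp).1 α.2
  have h := reducedSharp_eq hΦ hπ hinv hp α hX
  have h₁ : Ω.flat p X X = 0 := Ω.alternating p X
  rw [hX] at h₁
  exact (congrArg (α.1 : F →L[ℝ] (Fin k → ℝ)) h).trans h₁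

theorem reducedSharp_nondegenerate
    (hΦ : ∀ g : G, ContMDiff 𝓘(ℝ, E) 𝓘(ℝ, E) ∞ (fun x : M ↦ g • x))
    (hπ : Manifold.IsSubmersion 𝓘(ℝ, E) 𝓘(ℝ, F) ∞ (proj (M := M) G)) (hinv : IsInvariant G Ω)
    (hV : ∀ p : M, (annihilator k (Ω.orthogonal (vertical G F p)) ⊓
      annihilator k (vertical G F p) ⊓ Ω.image p).comap (Ω.flat p) ≤ vertical G F p)
    (q : MulAction.orbitRel.Quotient G M) (α : reducedSubspace (F := F) Ω q)
    (h : ∀ β : reducedSubspace (F := F) Ω q, (α : KCovector F k q) (reducedSharp Ω q β) = 0) :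
    reducedSharp Ω q α = 0 := by
  obtain ⟨p, hp⟩ := proj_surjective q
  obtain ⟨X, hX⟩ := (mem_reducedSubspace_iff hΦ hπ.contMDiff hinv hp).1 α.2
  refine (reducedSharp_eq hΦ hπ.contMDiff hinv hp α hX).trans ?_
  refine hV p (x := X) ⟨⟨fun Y hY A ↦ ?_, ?_⟩, X, rfl⟩
  -- Y in (Vπ)^⊥ means that Ω♭Y kills Vπ, so Ω♭Y = π^*b for some b in the reduced fibre. The
  -- hypothesis on b then reads Ω(X, Y) = 0, which places Ω♭X in the annihilator of (Vπ)^⊥.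
  · obtain ⟨b, hb⟩ := exists_pullAt_eq (tangentProj_surjective hπ p) (b := Ω.flat p Y) hY
    have hβ := h ⟨b, (mem_reducedSubspace_iff hΦ hπ.contMDiff hinv hp).2 ⟨Y, hb.symm⟩⟩
    have h₁ := reducedSharp_eq hΦ hπ.contMDiff hinv hp
      ⟨b, (mem_reducedSubspace_iff hΦ hπ.contMDiff hinv hp).2 ⟨Y, hb.symm⟩⟩ hb.symm
    rw [hX]
    exact congrFun ((congrArg (α.1 : F →L[ℝ] (Fin k → ℝ)) h₁).symm.trans hβ) A
  · rw [hX]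
    exact pullAt_mem_annihilator p _

variable [IsManifold 𝓘(ℝ, F) ∞ (MulAction.orbitRel.Quotient G M)]

/-- The lifts X, Y of α, β satisfy the bracket formula for Ω♭[X, Y]. By naturality its right side is
π^* of the required `k`-covector, so [X, Y] is the lift of that covector; projecting by Tπ gives
both claims. -/
theorem reducedSharp_integrable [T2Space M]
    (hΦ : ∀ g : G, ContMDiff 𝓘(ℝ, E) 𝓘(ℝ, E) ∞ (fun x : M ↦ g • x))
    (hπ : Manifold.IsSubmersion 𝓘(ℝ, E) 𝓘(ℝ, F) ∞ (proj (M := M) G)) (hinv : IsInvariant G Ω)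
    (α β : ∀ q, reducedSubspace (F := F) (G := G) Ω q)
    (hα : SmoothKCovectorOn (fun q ↦ (α q : KCovector F k q)) Set.univ)
    (hβ : SmoothKCovectorOn (fun q ↦ (β q : KCovector F k q)) Set.univ)
    (q : MulAction.orbitRel.Quotient G M) :
    ∃ h : lieDerivAt (fun y ↦ reducedSharp Ω y (α y)) (fun y ↦ (β y : KCovector F k y)) q
        - lieDerivAt (fun y ↦ reducedSharp Ω y (β y)) (fun y ↦ (α y : KCovector F k y)) q
        - mvfderiv 𝓘(ℝ, F) (fun y ↦ (β y : KCovector F k y) (reducedSharp Ω y (α y))) q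
        ∈ reducedSubspace Ω q,
      mlieBracket 𝓘(ℝ, F) (fun y ↦ reducedSharp Ω y (α y)) (fun y ↦ reducedSharp Ω y (β y)) q
        = reducedSharp Ω q ⟨_, h⟩ := by
  have : CompleteSpace E := FiniteDimensional.complete ℝ E
  have : CompleteSpace F := FiniteDimensional.complete ℝ F
  obtain ⟨p, rfl⟩ := proj_surjective q
  rw [smoothKCovectorOn_iff isOpen_univ] at hα hβ
  have hα' := fun y ↦ hα y (Set.mem_univ y)
  have hβ' := fun y ↦ hβ y (Set.mem_univ y)
  let X := liftField hΦ hπ.contMDiff hinv α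
  let Y := liftField hΦ hπ.contMDiff hinv β
  have hX : ∀ x, SmoothVectorFieldAt X x := fun x ↦
    smoothVectorFieldAt_liftField hΦ hπ.contMDiff hinv (hα' _)
  have hY : ∀ x, SmoothVectorFieldAt Y x := fun x ↦
    smoothVectorFieldAt_liftField hΦ hπ.contMDiff hinv (hβ' _)
  have hX' := smoothVectorFieldAt_reducedSharp hΦ hπ hinv (hα' (proj G p))
  have hY' := smoothVectorFieldAt_reducedSharp hΦ hπ hinv (hβ' (proj G p))
  have hXr : ∀ x, mfderiv 𝓘(ℝ, E) 𝓘(ℝ, F) (proj (M := M) G) x (X x) =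
      reducedSharp Ω (proj G x) (α (proj G x)) := mfderiv_proj_liftField hΦ hπ.contMDiff hinv α
  have hYr : ∀ x, mfderiv 𝓘(ℝ, E) 𝓘(ℝ, F) (proj (M := M) G) x (Y x) =
      reducedSharp Ω (proj G x) (β (proj G x)) := mfderiv_proj_liftField hΦ hπ.contMDiff hinv β
  have hfX : (fun x ↦ Ω.flat x (X x)) = fun x ↦
      (α (proj G x)).1.comp (mfderiv 𝓘(ℝ, E) 𝓘(ℝ, F) (proj (M := M) G) x) :=
    funext fun x ↦ flat_liftField hΦ hπ.contMDiff hinv α x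
  have hfY : (fun x ↦ Ω.flat x (Y x)) = fun x ↦
      (β (proj G x)).1.comp (mfderiv 𝓘(ℝ, E) 𝓘(ℝ, F) (proj (M := M) G) x) :=
    funext fun x ↦ flat_liftField hΦ hπ.contMDiff hinv β x
  have hbr := mfderiv_mlieBracket_of_related hπ.contMDiff.contMDiffAt (hX p) (hY p) hX' hY'
    (.of_forall hXr) (.of_forall hYr)
  have hfl := Ω.flat_mlieBracket ((smoothVectorFieldOn_iff isOpen_univ).2 fun x _ ↦ hX x)
    ((smoothVectorFieldOn_iff isOpen_univ).2 fun x _ ↦ hY x) p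
  have hd : (fun y ↦ Ω.flat y (Y y) (X y)) =
      (fun y ↦ (β y : KCovector F k y) (reducedSharp Ω y (α y))) ∘ proj (M := M) G := by
    funext x
    exact (DFunLike.congr_fun (congrFun hfY x) (X x)).trans
      (congrArg (β (proj G x)).1 (hXr x))
  have hdiff : MDifferentiableAt 𝓘(ℝ, F) 𝓘(ℝ, Fin k → ℝ)
      (fun y ↦ (β y : KCovector F k y) (reducedSharp Ω y (α y))) (proj G p) :=
    (hβ' (proj G p)).mdifferentiableAt_apply hX'
  have hdc := mfderiv_comp p hdiff (hπ.contMDiff.mdifferentiable (by simp) p)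
  -- Each Lie derivative upstairs becomes the pullback of one downstairs; the differential is
  -- treated separately by the chain rule `hdc`.
  rw [hfX, hfY, hd, lieDerivAt_pullback hπ.contMDiff.contMDiffAt (hX p) hX' (hβ' _)
    (.of_forall hXr), lieDerivAt_pullback hπ.contMDiff.contMDiffAt (hY p) hY' (hα' _)
    (.of_forall hYr)] at hfl
  have hfl' : Ω.flat p (mlieBracket 𝓘(ℝ, E) X Y p) = pullAt G F p
      (lieDerivAt (fun y ↦ reducedSharp Ω y (α y)) (fun y ↦ (β y : KCovector F k y)) (proj G p)
        - lieDerivAt (fun y ↦ reducedSharp Ω y (β y)) (fun y ↦ (α y : KCovector F k y)) (proj G p)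
        - mvfderiv 𝓘(ℝ, F) (fun y ↦ (β y : KCovector F k y) (reducedSharp Ω y (α y)))
          (proj G p)) := by
    rw [hfl]
    ext1 v
    refine congrArg₂ (fun a b : Fin k → ℝ ↦ a - b) rfl ?_
    exact DFunLike.congr_fun hdc v
  refine ⟨(mem_reducedSubspace_iff hΦ hπ.contMDiff hinv rfl).2 ⟨_, hfl'⟩, ?_⟩
  rw [← hbr]
  exact (reducedSharp_eq hΦ hπ.contMDiff hinv rfl _ hfl').symm

/-- The reduced poly-Poisson structure on the orbit space. -/
def reducedStructure [T2Space M]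
    (hΦ : ∀ g : G, ContMDiff 𝓘(ℝ, E) 𝓘(ℝ, E) ∞ (fun x : M ↦ g • x))
    (hπ : Manifold.IsSubmersion 𝓘(ℝ, E) 𝓘(ℝ, F) ∞ (proj (M := M) G)) (hinv : IsInvariant G Ω)
    (hS : IsSubbundle (basicImage (E := E) G F Ω))
    (hV : ∀ p : M, (annihilator k (Ω.orthogonal (vertical G F p)) ⊓
      annihilator k (vertical G F p) ⊓ Ω.image p).comap (Ω.flat p) ≤ vertical G F p) :
    PolyPoissonStructure F k (MulAction.orbitRel.Quotient G M) where
  S := reducedSubspace Ω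
  sharp := reducedSharp Ω
  isSubbundle := isSubbundle_reducedSubspace hΦ hπ hinv hS
  smooth_sharp _ hU _ hσ := (smoothVectorFieldOn_iff hU).2 fun q hq ↦
    smoothVectorFieldAt_reducedSharp hΦ hπ hinv ((smoothKCovectorOn_iff hU).1 hσ q hq)
  skew := reducedSharp_skew hΦ hπ.contMDiff hinv
  nondegenerate := reducedSharp_nondegenerate hΦ hπ hinv hV
  integrable := reducedSharp_integrable hΦ hπ hinv

theorem isReduction_reducedStructure [T2Space M]
    (hΦ : ∀ g : G, ContMDiff 𝓘(ℝ, E) 𝓘(ℝ, E) ∞ (fun x : M ↦ g • x))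
    (hπ : Manifold.IsSubmersion 𝓘(ℝ, E) 𝓘(ℝ, F) ∞ (proj (M := M) G)) (hinv : IsInvariant G Ω)
    (hS : IsSubbundle (basicImage (E := E) G F Ω))
    (hV : ∀ p : M, (annihilator k (Ω.orthogonal (vertical G F p)) ⊓
      annihilator k (vertical G F p) ⊓ Ω.image p).comap (Ω.flat p) ≤ vertical G F p) :
    IsReduction Ω (reducedStructure hΦ hπ hinv hS hV) where
  mem_iff p _ := mem_reducedSubspace_iff hΦ hπ.contMDiff hinv (p := p) rfl
  sharp_eq p α _ hX := reducedSharp_eq hΦ hπ.contMDiff hinv (p := p) rfl α hX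

theorem IsReduction.unique {P P' : PolyPoissonStructure F k (MulAction.orbitRel.Quotient G M)}
    (h : IsReduction Ω P) (h' : IsReduction Ω P') : P = P' := by
  have hS : P.S = P'.S := by
    funext q
    obtain ⟨p, rfl⟩ := proj_surjective q
    ext α
    rw [h.mem_iff, h'.mem_iff]
  obtain ⟨S, sharp, _, _, _, _, _⟩ := P
  obtain ⟨S', sharp', _, _, _, _, _⟩ := P'
  obtain rfl : S = S' := hS
  congr
  funext q
  obtain ⟨p, rfl⟩ := proj_surjective q
  ext1 α
  obtain ⟨X, hX⟩ := (h.mem_iff p α.1).1 α.2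
  rw [h.sharp_eq p α X hX]
  exact (h'.sharp_eq p α X hX).symm

end ReducedPolyPoisson

end PolyPoisson

/-! ### The reduced bundle as a quotient by the lifted action. -/

namespace PolyPoisson

section QuotientBundle

variable {E : Type*} [NormedAddCommGroup E] [NormedSpace ℝ E] {k : ℕ}
  {M : Type*} [TopologicalSpace M] [ChartedSpace E M] [IsManifold 𝓘(ℝ, E) ∞ M]
  {G : Type*} [Group G] [MulAction G M]
  {F : Type*} [NormedAddCommGroup F] [NormedSpace ℝ F] [FiniteDimensional ℝ F]
  [ChartedSpace F (MulAction.orbitRel.Quotient G M)]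
  {Ω : PolysymplecticStructure E k M}

theorem exists_mem_pullAt_eq
    (hΦ : ∀ g : G, ContMDiff 𝓘(ℝ, E) 𝓘(ℝ, E) ∞ (fun x : M ↦ g • x))
    (hπ : Manifold.IsSubmersion 𝓘(ℝ, E) 𝓘(ℝ, F) ∞ (proj (M := M) G)) (hinv : IsInvariant G Ω)
    (x : BasicImageTotal G F Ω) :
    ∃ a : F →L[ℝ] (Fin k → ℝ), a ∈ reducedSubspace (F := F) Ω (proj G x.1.1) ∧
      pullAt G F x.1.1 a = x.1.2 := by
  have h := x.2
  rw [← map_pullAt_reducedSubspace hΦ hπ hinv rfl] at h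
  exact h

/-- The map from `S ∩ ((Vπ)°)ᵏ` to the reduced bundle inverting `(T^*π)ᵏ` fibrewise. -/
def basicImageProj
    (hΦ : ∀ g : G, ContMDiff 𝓘(ℝ, E) 𝓘(ℝ, E) ∞ (fun x : M ↦ g • x))
    (hπ : Manifold.IsSubmersion 𝓘(ℝ, E) 𝓘(ℝ, F) ∞ (proj (M := M) G)) (hinv : IsInvariant G Ω)
    (x : BasicImageTotal G F Ω) :
    {y : KCovelocities F k (MulAction.orbitRel.Quotient G M) // y.2 ∈ reducedSubspace Ω y.1} :=
  ⟨⟨proj G x.1.1, (exists_mem_pullAt_eq hΦ hπ hinv x).choose⟩,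
    (exists_mem_pullAt_eq hΦ hπ hinv x).choose_spec.1⟩

variable (hΦ : ∀ g : G, ContMDiff 𝓘(ℝ, E) 𝓘(ℝ, E) ∞ (fun x : M ↦ g • x))
    (hπ : Manifold.IsSubmersion 𝓘(ℝ, E) 𝓘(ℝ, F) ∞ (proj (M := M) G)) (hinv : IsInvariant G Ω)

theorem pullAt_basicImageProj (x : BasicImageTotal G F Ω) :
    pullAt G F x.1.1 (basicImageProj hΦ hπ hinv x).1.2 = x.1.2 :=
  (exists_mem_pullAt_eq hΦ hπ hinv x).choose_spec.2

theorem basicImageProj_eq (x : BasicImageTotal G F Ω)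
    {y : {y : KCovelocities F k (MulAction.orbitRel.Quotient G M) // y.2 ∈ reducedSubspace Ω y.1}}
    (hxy : proj G x.1.1 = y.1.1) (h : pullAt G F x.1.1 y.1.2 = x.1.2) :
    basicImageProj hΦ hπ hinv x = y := by
  have h₁ := pullAt_injective (tangentProj_surjective hπ x.1.1)
    ((pullAt_basicImageProj hΦ hπ hinv x).trans h.symm)
  apply Subtype.ext
  obtain ⟨⟨q, a⟩, ha⟩ := y
  change (⟨proj G x.1.1, (basicImageProj hΦ hπ hinv x).1.2⟩ : TotalSpace _
    (fun _ ↦ (F →L[ℝ] (Fin k → ℝ)))) = ⟨q, a⟩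
  rw [h₁]
  exact mk_eq_mk_of_eq hxy _

/-- Two points with the same image are pullbacks of one covector at points p and g • p. Since T(g •
p)π ∘ TΦ_g = T_pπ, the lifted action of g takes one pullback to the other. -/
theorem basicImageProj_eq_iff {x y : BasicImageTotal G F Ω} :
    basicImageProj hΦ hπ hinv x = basicImageProj hΦ hπ hinv y ↔ LiftedRel G x.1 y.1 := by
  constructor
  · intro h
    have h₁ : proj G x.1.1 = proj G y.1.1 := congrArg (fun z ↦ z.1.1) h
    have h₂ : ((basicImageProj hΦ hπ hinv x).1.2 : F →L[ℝ] (Fin k → ℝ)) =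
        (basicImageProj hΦ hπ hinv y).1.2 :=
      congrArg (fun z ↦ ((z.1.2 : _) : F →L[ℝ] (Fin k → ℝ))) h
    have h₃ := pullAt_basicImageProj hΦ hπ hinv x
    have h₄ := pullAt_basicImageProj hΦ hπ hinv y
    rw [← h₂] at h₄
    generalize ((basicImageProj hΦ hπ hinv x).1.2 : F →L[ℝ] (Fin k → ℝ)) = a at h₃ h₄
    clear h h₂
    obtain ⟨⟨p, b⟩, hx⟩ := x
    obtain ⟨⟨p', b'⟩, hy⟩ := y
    obtain ⟨g, rfl⟩ := proj_eq_iff.1 h₁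
    refine ⟨g, p, b, b', rfl, rfl, ?_⟩
    have h₅ : pullAt G F p a = b := h₃
    have h₆ : pullAt G F (g • p) a = b' := h₄
    rw [← h₅, ← h₆]
    ext1 v
    exact congrArg a (tangentProj_smul hΦ hπ.contMDiff g p v)
  · obtain ⟨x, hx⟩ := x
    obtain ⟨y, hy⟩ := y
    rintro ⟨g, p, a, b, rfl, rfl, h⟩
    refine basicImageProj_eq hΦ hπ hinv _ (proj_smul g p).symm ?_
    have h₄ := pullAt_basicImageProj hΦ hπ hinv ⟨⟨g • p, b⟩, hy⟩
    generalize (basicImageProj hΦ hπ hinv ⟨⟨g • p, b⟩, hy⟩).1.2 = c at h₄ ⊢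
    have h₅ : pullAt G F (g • p) c = b := h₄
    change pullAt G F p c = a
    rw [← h, ← h₅]
    ext1 v
    exact (congrArg (c : F →L[ℝ] (Fin k → ℝ)) (tangentProj_smul hΦ hπ.contMDiff g p v)).symm

variable [IsManifold 𝓘(ℝ, F) ∞ (MulAction.orbitRel.Quotient G M)]

/-- Composing the output with Tπ gives back the inclusion of S ∩ (Vπ)^{∘k}, which is continuous;
surjectivity of Tπ allows the composition to be undone continuously. -/
theorem continuous_basicImageProj : Continuous (basicImageProj hΦ hπ hinv) := by
  rw [continuous_iff_continuousAt]
  intro z₀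
  refine Topology.IsInducing.subtypeVal.continuousAt_iff.2 ?_
  have hc : Continuous fun z : BasicImageTotal G F Ω ↦ z.1.1 :=
    (FiberBundle.continuous_proj (E →L[ℝ] (Fin k → ℝ)) _).comp continuous_subtype_val
  refine continuousAt_kCovector_of_comp (c := fun z : BasicImageTotal G F Ω ↦ z.1.1)
    (b := fun z : BasicImageTotal G F Ω ↦ proj G z.1.1)
    (α := fun z ↦ (basicImageProj hΦ hπ hinv z).1.2) (z₀ := z₀)
    (ϕ := fun z ↦ mfderiv 𝓘(ℝ, E) 𝓘(ℝ, F) (proj (M := M) G) z.1.1) ?_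
    (hπ.contMDiff.continuous.comp hc).continuousAt ?_ (tangentProj_surjective hπ z₀.1.1)
  · have h : ∀ z : BasicImageTotal G F Ω, (⟨z.1.1, pullAt G F z.1.1
        (basicImageProj hΦ hπ hinv z).1.2⟩ : KCovelocities E k M) = z.1 := fun z ↦ by
      rw [pullAt_basicImageProj]
    exact continuous_subtype_val.continuousAt.congr (.of_forall fun z ↦ (h z).symm)
  · have h := (hπ.contMDiff.contMDiffAt (x := z₀.1.1)).mfderiv_const (m := ∞) (by simp)
    exact h.continuousAt.comp (f := fun z : BasicImageTotal G F Ω ↦ z.1.1) hc.continuousAt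

/-- Pulling back at s(q), for a local section s of π, gives a local right inverse that is continuous
at the image of `z₀` and returns to `z₀` there. -/
theorem isOpenMap_basicImageProj : IsOpenMap (basicImageProj hΦ hπ hinv) := by
  rw [isOpenMap_iff_nhds_le]
  intro z₀
  obtain ⟨V, s, hV, hpV, hs, hsp, hsec⟩ := hπ.exists_local_section z₀.1.1
  let Y := {y : KCovelocities F k (MulAction.orbitRel.Quotient G M) //
    y.2 ∈ reducedSubspace Ω y.1}
  have hpr : Continuous fun y : Y ↦ y.1.1 :=
    (FiberBundle.continuous_proj (F →L[ℝ] (Fin k → ℝ)) _).comp continuous_subtype_val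
  have hmem : ∀ y : Y, y.1.1 ∈ V → pullAt G F (s y.1.1) y.1.2 ∈ basicImage G F Ω (s y.1.1) := by
    intro y hy
    rw [← map_pullAt_reducedSubspace hΦ hπ hinv (hsec _ hy)]
    exact ⟨_, y.2, rfl⟩
  classical
  let h : Y → BasicImageTotal G F Ω := fun y ↦
    if hy : y.1.1 ∈ V then ⟨⟨s y.1.1, pullAt G F (s y.1.1) y.1.2⟩, hmem y hy⟩ else z₀
  have hval : ∀ y : Y, y.1.1 ∈ V → (h y).1 = ⟨s y.1.1, pullAt G F (s y.1.1) y.1.2⟩ :=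
    fun y hy ↦ by simp only [h, dif_pos hy]
  have hVy : ∀ᶠ y in 𝓝 (basicImageProj hΦ hπ hinv z₀), y.1.1 ∈ V :=
    hpr.continuousAt (hV.mem_nhds hpV)
  have hsc : ContinuousAt (fun y : Y ↦ s y.1.1) (basicImageProj hΦ hπ hinv z₀) :=
    ContinuousAt.comp (g := s) ((hs.contMDiffAt (hV.mem_nhds hpV)).continuousAt) hpr.continuousAt
  have hh₀ : h (basicImageProj hΦ hπ hinv z₀) = z₀ := by
    apply Subtype.ext
    rw [hval _ hpV]
    have h₁ := pullAt_basicImageProj hΦ hπ hinv z₀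
    have h₂ : ∀ p, p = z₀.1.1 → (⟨p, pullAt G F p (basicImageProj hΦ hπ hinv z₀).1.2⟩ :
        KCovelocities E k M) = z₀.1 := by
      rintro _ rfl
      rw [h₁]
    exact h₂ _ hsp
  refine Filter.le_map_of_right_inverse (mba := h) ?_ ?_
  · filter_upwards [hVy] with y hy
    refine basicImageProj_eq hΦ hπ hinv _ ?_ ?_
    · rw [hval y hy]
      exact hsec _ hy
    · rw [hval y hy]
      rfl
  · suffices hc : ContinuousAt h (basicImageProj hΦ hπ hinv z₀) by
      have := hc.tendsto
      rwa [hh₀] at this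
    refine Topology.IsInducing.subtypeVal.continuousAt_iff.2 ?_
    refine ContinuousAt.congr ?_ (hVy.mono fun y hy ↦ (hval y hy).symm)
    refine continuousAt_kCovector_comp (c := fun y : Y ↦ s y.1.1) (b := fun y ↦ proj G (s y.1.1))
      (α := fun y ↦ y.1.2)
      (ϕ := fun y ↦ mfderiv 𝓘(ℝ, E) 𝓘(ℝ, F) (proj (M := M) G) (s y.1.1)) ?_ hsc ?_
    · refine continuous_subtype_val.continuousAt.congr ?_
      filter_upwards [hVy] with y hy
      exact mk_eq_mk_of_eq (hsec _ hy).symm y.1.2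
    · have h := (hπ.contMDiff.contMDiffAt (x := s (proj G z₀.1.1))).mfderiv_const (m := ∞)
        (by simp)
      exact h.continuousAt.comp (f := fun y : Y ↦ s y.1.1) hsc

theorem surjective_basicImageProj : Function.Surjective (basicImageProj hΦ hπ hinv) := by
  intro y
  obtain ⟨p, hp⟩ := proj_surjective y.1.1
  have h : pullAt G F p y.1.2 ∈ basicImage G F Ω p := by
    rw [← map_pullAt_reducedSubspace hΦ hπ hinv hp]
    exact ⟨_, y.2, rfl⟩
  exact ⟨⟨⟨p, pullAt G F p y.1.2⟩, h⟩, basicImageProj_eq hΦ hπ hinv _ hp rfl⟩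

/-- The quotient of `S ∩ ((Vπ)°)ᵏ` by the lifted action is the reduced bundle. -/
def basicImageQuotientHomeomorph : BasicImageQuotient G F Ω ≃ₜ
    {y : KCovelocities F k (MulAction.orbitRel.Quotient G M) // y.2 ∈ reducedSubspace Ω y.1} :=
  (Equiv.ofBijective (Quot.lift (basicImageProj hΦ hπ hinv)
      fun _ _ ↦ (basicImageProj_eq_iff hΦ hπ hinv).2) <| by
    constructor
    -- `LiftedRel` is exactly the relation of having equal images, so one generating step of the
    -- quotient suffices.
    · rintro ⟨x⟩ ⟨y⟩ h
      exact Quot.sound ((basicImageProj_eq_iff hΦ hπ hinv).1 h)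
    · intro y
      obtain ⟨x, rfl⟩ := surjective_basicImageProj hΦ hπ hinv y
      exact ⟨Quot.mk _ x, rfl⟩).toHomeomorphOfContinuousOpen
    (continuous_quot_lift _ (continuous_basicImageProj hΦ hπ hinv)) <| by
      refine fun U hU ↦ ?_
      have h := isOpenMap_basicImageProj hΦ hπ hinv _ (isOpen_coinduced.1 hU)
      convert h using 1
      ext y
      constructor
      · rintro ⟨⟨x⟩, hx, rfl⟩
        exact ⟨x, hx, rfl⟩
      · rintro ⟨x, hx, rfl⟩
        exact ⟨Quot.mk _ x, hx, rfl⟩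

theorem isQuotientBundle_reducedSubspace
    (hΦ : ∀ g : G, ContMDiff 𝓘(ℝ, E) 𝓘(ℝ, E) ∞ (fun x : M ↦ g • x))
    (hπ : Manifold.IsSubmersion 𝓘(ℝ, E) 𝓘(ℝ, F) ∞ (proj (M := M) G)) (hinv : IsInvariant G Ω) :
    IsQuotientBundle Ω (reducedSubspace (F := F) (G := G) Ω) where
  injective p := (pullAt_injective (tangentProj_surjective hπ p)).injOn
  map_eq p := map_pullAt_reducedSubspace hΦ hπ hinv (p := p) rfl
  homeomorph := ⟨basicImageQuotientHomeomorph hΦ hπ hinv, fun x α h ↦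
    basicImageProj_eq hΦ hπ hinv x (y := ⟨⟨proj G x.1.1, α⟩, α.2⟩) rfl h⟩
  smooth_iff U hU σ := by
    rw [smoothKCovectorOn_iff hU,
      smoothKCovectorOn_iff (hU.preimage hπ.contMDiff.continuous)]
    constructor
    · intro h p hp
      exact (h _ hp).pullback hπ.contMDiff.contMDiffAt
    · intro h q hq
      obtain ⟨p, rfl⟩ := proj_surjective q
      obtain ⟨V, s, hV, hpV, hs, hsp, hsec⟩ := hπ.exists_local_section p
      have h₁ := h p hq
      rw [← hsp] at h₁
      -- σ is recovered near π(p) as s^*π^*σ, since π ∘ s is the identity.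
      refine (h₁.pullback (hs.contMDiffAt (hV.mem_nhds hpV))).congr ?_
      filter_upwards [hV.mem_nhds hpV] with q hq
      have h₅ : ∀ q' : MulAction.orbitRel.Quotient G M, q' = q →
          ((σ q').1 : F →L[ℝ] (Fin k → ℝ)) = (σ q).1 := by
        rintro _ rfl
        rfl
      refine (comp_section_pullAt hπ hV hs hsec hq (σ q).1).symm.trans ?_
      exact congrArg (fun a : F →L[ℝ] (Fin k → ℝ) ↦ (pullAt (E := E) G F (s q) a).comp
        (mfderiv 𝓘(ℝ, F) 𝓘(ℝ, E) s q)) (h₅ _ (hsec q hq)).symm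

end QuotientBundle

end PolyPoisson

/-! ### Charts of the orbit space from adapted charts of `M`. -/

theorem continuousOn_comp_invFunOn {X Y Z : Type*} [TopologicalSpace X] [TopologicalSpace Y]
    [TopologicalSpace Z] [Nonempty X] {S : Set X} {f : X → Y} {u : X → Z} (hS : IsOpen S)
    (hf : ∀ T ⊆ S, IsOpen T → IsOpen (f '' T)) (hu : ContinuousOn u S)
    (hfu : ∀ x ∈ S, ∀ y ∈ S, f x = f y → u x = u y) :
    ContinuousOn (u ∘ Function.invFunOn f S) (f '' S) := by
  have hmem : ∀ y ∈ f '' S, Function.invFunOn f S y ∈ S := fun y hy ↦ Function.invFunOn_mem hy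
  have heq : ∀ y ∈ f '' S, f (Function.invFunOn f S y) = y := fun y hy ↦ Function.invFunOn_eq hy
  rw [continuousOn_open_iff (hf S subset_rfl hS)]
  intro O hO
  -- As `u` is constant on the fibres of `f` in `S`, the preimage of `O` is f(S ∩ u⁻¹(O)), which is
  -- open.
  convert hf _ Set.inter_subset_left (hu.isOpen_inter_preimage hS hO) using 1
  ext y
  constructor
  · rintro ⟨hy, hyO⟩
    exact ⟨_, ⟨hmem y hy, hyO⟩, heq y hy⟩
  · rintro ⟨x, ⟨hx, hxO⟩, rfl⟩
    refine ⟨⟨x, hx, rfl⟩, ?_⟩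
    have := hfu _ (hmem _ ⟨x, hx, rfl⟩) _ hx (heq _ ⟨x, hx, rfl⟩)
    simpa [this] using hxO

/-- Two maps that are continuous and open on the open set `S` and have the same fibres in `S`
have homeomorphic images. -/
def OpenPartialHomeomorph.ofSameFibers {X Y Z : Type*} [TopologicalSpace X] [TopologicalSpace Y]
    [TopologicalSpace Z] [Nonempty X] {S : Set X} {f : X → Y} {u : X → Z} (hS : IsOpen S)
    (hf : ∀ T ⊆ S, IsOpen T → IsOpen (f '' T)) (hu : ∀ T ⊆ S, IsOpen T → IsOpen (u '' T))
    (hfc : ContinuousOn f S) (huc : ContinuousOn u S)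
    (hfu : ∀ x ∈ S, ∀ y ∈ S, u x = u y ↔ f x = f y) : OpenPartialHomeomorph Y Z where
  toFun := u ∘ Function.invFunOn f S
  invFun := f ∘ Function.invFunOn u S
  source := f '' S
  target := u '' S
  map_source' y hy := ⟨_, Function.invFunOn_mem hy, rfl⟩
  map_target' z hz := ⟨_, Function.invFunOn_mem hz, rfl⟩
  left_inv' := by
    rintro _ ⟨x, hx, rfl⟩
    have h₁ : ∃ y ∈ S, f y = f x := ⟨x, hx, rfl⟩
    have h₂ : ∃ y ∈ S, u y = u (Function.invFunOn f S (f x)) :=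
      ⟨_, Function.invFunOn_mem h₁, rfl⟩
    exact ((hfu _ (Function.invFunOn_mem h₂) _ (Function.invFunOn_mem h₁)).1
      (Function.invFunOn_eq h₂)).trans (Function.invFunOn_eq h₁)
  right_inv' := by
    rintro _ ⟨x, hx, rfl⟩
    have h₁ : ∃ y ∈ S, u y = u x := ⟨x, hx, rfl⟩
    have h₂ : ∃ y ∈ S, f y = f (Function.invFunOn u S (u x)) :=
      ⟨_, Function.invFunOn_mem h₁, rfl⟩
    exact ((hfu _ (Function.invFunOn_mem h₂) _ (Function.invFunOn_mem h₁)).2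
      (Function.invFunOn_eq h₂)).trans (Function.invFunOn_eq h₁)
  open_source := hf S subset_rfl hS
  open_target := hu S subset_rfl hS
  continuousOn_toFun := continuousOn_comp_invFunOn hS hf huc fun x hx y hy ↦ (hfu x hx y hy).2
  continuousOn_invFun := continuousOn_comp_invFunOn hS hu hfc fun x hx y hy ↦ (hfu x hx y hy).1

namespace PolyPoisson

section AdaptedCharts

variable {E : Type*} [NormedAddCommGroup E] [NormedSpace ℝ E]
  {M : Type*} [TopologicalSpace M] [ChartedSpace E M]
  {G : Type*} [Group G] [MulAction G M]
  {F : Type*} [NormedAddCommGroup F] [NormedSpace ℝ F]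
  {K : Type*} [NormedAddCommGroup K] [NormedSpace ℝ K]

variable (G) in
/-- A chart `e` of `M`, with the model space split by `L`, is adapted to the action of `G` if the
intersections of the orbits with its domain are the level sets of the first coordinate. -/
structure IsAdaptedChart (e : OpenPartialHomeomorph M E) (L : E ≃L[ℝ] F × K) : Prop where
  mem_maximalAtlas : e ∈ IsManifold.maximalAtlas 𝓘(ℝ, E) ∞ M
  fst_eq_iff : ∀ x ∈ e.source, ∀ y ∈ e.source, (L (e x)).1 = (L (e y)).1 ↔ proj G x = proj G y

namespace IsAdaptedChart

variable {e e' : OpenPartialHomeomorph M E} {L L' : E ≃L[ℝ] F × K}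

/-- The chart of the orbit space given by the first coordinate of an adapted chart. -/
def quotientChart [ContinuousConstSMul G M] [Nonempty M] (h : IsAdaptedChart G e L) :
    OpenPartialHomeomorph (MulAction.orbitRel.Quotient G M) F :=
  OpenPartialHomeomorph.ofSameFibers (f := proj G) (u := fun x ↦ (L (e x)).1) e.open_source
    (fun T _ hT ↦ isOpenMap_quotient_mk'_mul T hT)
    (fun T hT hTo ↦ by
      have h₁ := (isOpenMap_fst.comp L.toHomeomorph.isOpenMap) _
        (e.isOpen_image_of_subset_source hTo hT)
      rwa [Set.image_image] at h₁)
    continuous_quotient_mk'.continuousOn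
    (continuous_fst.comp_continuousOn (L.continuous.comp_continuousOn e.continuousOn))
    h.fst_eq_iff

variable [ContinuousConstSMul G M] [Nonempty M]

theorem quotientChart_proj (h : IsAdaptedChart G e L) {x : M} (hx : x ∈ e.source) :
    h.quotientChart (proj G x) = (L (e x)).1 := by
  have h₁ : ∃ y ∈ e.source, proj G y = proj G x := ⟨x, hx, rfl⟩
  exact (h.fst_eq_iff _ (Function.invFunOn_mem h₁) _ hx).2 (Function.invFunOn_eq h₁)

theorem quotientChart_symm (h : IsAdaptedChart G e L) {x : M} (hx : x ∈ e.source) :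
    h.quotientChart.symm (L (e x)).1 = proj G x := by
  rw [← h.quotientChart_proj hx]
  exact h.quotientChart.left_inv ⟨x, hx, rfl⟩

/-- Near the coordinate of π(x), the transition lifts w to a slice of `e` through x, moves it by a
group element g with g • x in the domain of `e'`, and reads the first coordinate there. Each stage
is smooth. -/
theorem contDiffOn_quotientChart_transition
    (hΦ : ∀ g : G, ContMDiff 𝓘(ℝ, E) 𝓘(ℝ, E) ∞ (fun x : M ↦ g • x))
    (h : IsAdaptedChart G e L) (h' : IsAdaptedChart G e' L') :
    ContDiffOn ℝ ∞ (h'.quotientChart ∘ h.quotientChart.symm)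
      (h.quotientChart.symm ≫ₕ h'.quotientChart).source := by
  rintro w ⟨⟨x, hx, rfl⟩, hw⟩
  change h.quotientChart.symm (L (e x)).1 ∈ h'.quotientChart.source at hw
  rw [h.quotientChart_symm hx] at hw
  obtain ⟨y, hy, hyx⟩ := hw
  obtain ⟨g, rfl⟩ := proj_eq_iff.1 hyx.symm
  let j : F → E := fun w ↦ L.symm (w, (L (e x)).2)
  have hj : ContDiff ℝ ∞ j := L.symm.contDiff.comp (contDiff_id.prodMk contDiff_const)
  have hjx : j (L (e x)).1 = e x := L.symm_apply_apply _
  have hjt : j (L (e x)).1 ∈ e.target := by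
    rw [hjx]
    exact e.map_source hx
  have h₁ : ContMDiffAt 𝓘(ℝ, F) 𝓘(ℝ, E) ∞ (fun w ↦ e.symm (j w)) (L (e x)).1 :=
    ((contMDiffOn_symm_of_mem_maximalAtlas h.mem_maximalAtlas).contMDiffAt
      (e.open_target.mem_nhds hjt)).comp _ hj.contMDiff.contMDiffAt
  have h₁x : e.symm (j (L (e x)).1) = x := by rw [hjx, e.left_inv hx]
  have h₂ : ContMDiffAt 𝓘(ℝ, F) 𝓘(ℝ, E) ∞ (fun w ↦ g • e.symm (j w)) (L (e x)).1 :=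
    (hΦ g).contMDiffAt.comp _ h₁
  have h₃ : ContMDiffAt 𝓘(ℝ, F) 𝓘(ℝ, E) ∞ (fun w ↦ e' (g • e.symm (j w))) (L (e x)).1 := by
    refine ContMDiffAt.comp (g := e') _ ?_ h₂
    rw [h₁x]
    exact (contMDiffOn_of_mem_maximalAtlas h'.mem_maximalAtlas).contMDiffAt
      (e'.open_source.mem_nhds hy)
  have h₄ : ContDiffAt ℝ ∞ (fun w ↦ (L' (e' (g • e.symm (j w)))).1) (L (e x)).1 :=
    contDiff_fst.contDiffAt.comp _ (L'.contDiff.contDiffAt.comp _ h₃.contDiffAt)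
  refine (h₄.congr_of_eventuallyEq ?_).contDiffWithinAt
  have hev₁ : ∀ᶠ w in 𝓝 (L (e x)).1, j w ∈ e.target :=
    hj.continuous.continuousAt (e.open_target.mem_nhds hjt)
  have hev₂ : ∀ᶠ w in 𝓝 (L (e x)).1, g • e.symm (j w) ∈ e'.source := by
    refine h₂.continuousAt (e'.open_source.mem_nhds ?_)
    rwa [h₁x]
  filter_upwards [hev₁, hev₂] with w hw₁ hw₂
  have h₅ := h.quotientChart_symm (e.map_target hw₁)
  rw [e.right_inv hw₁] at h₅
  simp only [j, L.apply_symm_apply] at h₅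
  rw [Function.comp_apply, h₅, ← proj_smul g]
  exact h'.quotientChart_proj hw₂

end IsAdaptedChart

/-- If there are adapted charts around all points of `M`, then the orbit space has a smooth
structure for which the projection is a submersion. -/
theorem exists_chartedSpace_of_isAdaptedChart [ContinuousConstSMul G M] [Nonempty M]
    (hΦ : ∀ g : G, ContMDiff 𝓘(ℝ, E) 𝓘(ℝ, E) ∞ (fun x : M ↦ g • x))
    (hex : ∀ p : M, ∃ (e : OpenPartialHomeomorph M E) (L : E ≃L[ℝ] F × K),
      IsAdaptedChart G e L ∧ p ∈ e.source) :
    ∃ (_ : ChartedSpace F (MulAction.orbitRel.Quotient G M)),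
      IsManifold 𝓘(ℝ, F) ∞ (MulAction.orbitRel.Quotient G M) ∧
      Manifold.IsSubmersion 𝓘(ℝ, E) 𝓘(ℝ, F) ∞ (proj (M := M) G) := by
  choose e L h he using hex
  let cs : ChartedSpace F (MulAction.orbitRel.Quotient G M) :=
    { atlas := Set.range fun p : M ↦ (h p).quotientChart
      chartAt := fun q ↦ (h (Quotient.out q)).quotientChart
      mem_chart_source := fun q ↦ ⟨Quotient.out q, he _, Quotient.out_eq q⟩
      chart_mem_atlas := fun q ↦ ⟨_, rfl⟩ }
  have hM : IsManifold 𝓘(ℝ, F) ∞ (MulAction.orbitRel.Quotient G M) := by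
    refine isManifold_of_contDiffOn _ _ _ ?_
    rintro _ _ ⟨p, rfl⟩ ⟨p', rfl⟩
    simpa using (h p).contDiffOn_quotientChart_transition hΦ (h p')
  refine ⟨cs, hM, Manifold.IsSubmersionOfComplement.isSubmersion (F := K) fun p ↦ ?_⟩
  -- In an adapted chart and the quotient chart it induces, π is literally the first projection.
  refine Manifold.IsSubmersionAtOfComplement.mk_of_charts (L p) (e p) (h p).quotientChart (he p)
    ⟨p, he p, rfl⟩ (h p).mem_maximalAtlas (IsManifold.subset_maximalAtlas ⟨p, rfl⟩)
    (fun x hx ↦ ⟨x, hx, rfl⟩) ?_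
  intro y hy
  have hy' : y ∈ (e p).target := by simpa using hy
  have := (h p).quotientChart_proj ((e p).map_target hy')
  rw [(e p).right_inv hy'] at this
  simpa using this

end AdaptedCharts

end PolyPoisson

/-! ### Inverse function theorem, proper actions and orbit maps. -/

/-- The inverse function theorem, with smoothness of the inverse on its whole domain. -/
theorem ContDiffOn.exists_openPartialHomeomorph {E F : Type*} [NormedAddCommGroup E]
    [NormedSpace ℝ E] [CompleteSpace E] [NormedAddCommGroup F] [NormedSpace ℝ F]
    {f : E → F} {s : Set E} {a : E} {f' : E ≃L[ℝ] F} (hs : IsOpen s) (ha : a ∈ s)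
    (hf : ContDiffOn ℝ ∞ f s) (hf' : HasFDerivAt f (f' : E →L[ℝ] F) a) :
    ∃ e : OpenPartialHomeomorph E F, a ∈ e.source ∧ e.source ⊆ s ∧ (e : E → F) = f ∧
      ContDiffOn ℝ ∞ e.symm e.target := by
  have hfa : ∀ x ∈ s, ContDiffAt ℝ ∞ f x := fun x hx ↦ hf.contDiffAt (hs.mem_nhds hx)
  let e₀ := (hfa a ha).toOpenPartialHomeomorph f hf' (by simp)
  have hc : ContinuousOn (fderiv ℝ f) s := hf.continuousOn_fderiv_of_isOpen hs (by simp)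
  -- The domain is shrunk to where the derivative stays invertible, so that the inverse is smooth at
  -- every point of the target.
  have hev : ∀ᶠ x in 𝓝 a, fderiv ℝ f x ∈ Set.range ((↑) : (E ≃L[ℝ] F) → E →L[ℝ] F) := by
    apply hc.continuousAt (hs.mem_nhds ha)
    rw [hf'.fderiv]
    exact f'.nhds
  obtain ⟨t, ht, hto, hat⟩ := eventually_nhds_iff.1 hev
  refine ⟨e₀.restrOpen (s ∩ t) (hs.inter hto),
    ⟨(hfa a ha).mem_toOpenPartialHomeomorph_source hf' (by simp), ha, hat⟩,
    fun x hx ↦ hx.2.1, rfl, fun y hy ↦ ContDiffAt.contDiffWithinAt ?_⟩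
  have hy' := (e₀.restrOpen (s ∩ t) (hs.inter hto)).map_target hy
  obtain ⟨A, hA⟩ := ht _ hy'.2.2
  refine OpenPartialHomeomorph.contDiffAt_symm _ hy (f₀' := A) ?_ (hfa _ hy'.2.1)
  rw [hA]
  exact ((hfa _ hy'.2.1).differentiableAt (by simp)).hasFDerivAt

section ProperAction

variable {G M : Type*} [TopologicalSpace G] [Group G] [TopologicalSpace M] [MulAction G M]

/-- In a free proper action, only elements close to the identity move points close to `p` to
points close to `p`. -/
theorem ProperSMul.exists_isOpen_forall_smul_mem [ProperSMul G M]
    (hfree : ∀ (g : G) (p : M), g • p = p → g = 1) (p : M) {V : Set G} (hV : V ∈ 𝓝 1) :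
    ∃ U : Set M, IsOpen U ∧ p ∈ U ∧ ∀ (g : G), ∀ x ∈ U, g • x ∈ U → g ∈ V := by
  -- The pairs (g • x, x) with g outside the interior of `V` form a closed set, which misses (p, p)
  -- by freeness. A product neighbourhood of (p, p) disjoint from it gives `U`.
  have hcl := (ProperSMul.isProperMap_smul_pair (G := G) (X := M)).isClosedMap
    ((interior V)ᶜ ×ˢ Set.univ) (isOpen_interior.isClosed_compl.prod isClosed_univ)
  have hp : (p, p) ∈ ((fun gx : G × M ↦ (gx.1 • gx.2, gx.2)) ''
      ((interior V)ᶜ ×ˢ Set.univ))ᶜ := by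
    rintro ⟨⟨g, x⟩, ⟨hg, -⟩, h⟩
    simp only [Prod.mk.injEq] at h
    obtain ⟨h, rfl⟩ := h
    rw [hfree g x h] at hg
    exact hg (mem_interior_iff_mem_nhds.2 hV)
  obtain ⟨A, B, hA, hB, hpA, hpB, hAB⟩ := isOpen_prod_iff.1 hcl.isOpen_compl p p hp
  refine ⟨A ∩ B, hA.inter hB, ⟨hpA, hpB⟩, fun g x hx hgx ↦ ?_⟩
  by_contra hg
  exact hAB (Set.mk_mem_prod hgx.1 hx.2) ⟨(g, x), ⟨fun h ↦ hg (interior_subset h), trivial⟩, rfl⟩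

end ProperAction

section OrbitMap

variable {E : Type*} [NormedAddCommGroup E] [NormedSpace ℝ E]
  {M : Type*} [TopologicalSpace M] [ChartedSpace E M] [IsManifold 𝓘(ℝ, E) ∞ M]
  {EG : Type*} [NormedAddCommGroup EG] [NormedSpace ℝ EG] [FiniteDimensional ℝ EG]
  {G : Type*} [TopologicalSpace G] [ChartedSpace EG G] [Group G]

/-- A curve in a manifold whose derivative vanishes near `t₀` is constant near `t₀`. -/
theorem eventually_eq_of_hasMFDerivAt_zero {c : ℝ → M} {t₀ : ℝ}
    (hc : ∀ᶠ t in 𝓝 t₀, HasMFDerivAt 𝓘(ℝ, ℝ) 𝓘(ℝ, E) c t 0) : ∀ᶠ t in 𝓝 t₀, c t = c t₀ := by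
  let φ := extChartAt 𝓘(ℝ, E) (c t₀)
  have hsrc : ∀ᶠ t in 𝓝 t₀, c t ∈ φ.source :=
    hc.self_of_nhds.continuousAt (extChartAt_source_mem_nhds _)
  have hsrc' : ∀ t, c t ∈ φ.source → c t ∈ (chartAt E (c t₀)).source := fun t ht ↦ by
    rwa [extChartAt_source] at ht
  obtain ⟨r, hr, hball⟩ := Metric.eventually_nhds_iff_ball.1 (hc.and hsrc)
  have hd : ∀ t ∈ Metric.ball t₀ r, HasFDerivAt (φ ∘ c) (0 : ℝ →L[ℝ] E) t := fun t ht ↦ by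
    have h₁ : MDifferentiableAt 𝓘(ℝ, E) 𝓘(ℝ, E) φ (c t) :=
      mdifferentiableAt_extChartAt (hsrc' t (hball t ht).2)
    have h₂ := h₁.hasMFDerivAt.comp t (hball t ht).1
    rw [ContinuousLinearMap.comp_zero] at h₂
    exact h₂.hasFDerivAt
  refine Filter.eventually_of_mem (Metric.ball_mem_nhds t₀ hr) fun t ht ↦ ?_
  have h₀ := Metric.mem_ball_self (x := t₀) hr
  refine φ.injOn (hball t ht).2 (hball t₀ h₀).2 ?_
  exact Metric.isOpen_ball.is_const_of_fderiv_eq_zero (convex_ball t₀ r).isPreconnected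
    (fun t ht ↦ (hd t ht).differentiableAt.differentiableWithinAt)
    (fun t ht ↦ (hd t ht).fderiv) ht h₀

theorem contMDiff_orbitMap [MulAction G M] [ContMDiffSMul 𝓘(ℝ, EG) 𝓘(ℝ, E) ∞ G M] (p : M) :
    ContMDiff 𝓘(ℝ, EG) 𝓘(ℝ, E) ∞ (fun g : G ↦ g • p) :=
  (contMDiff_smul (I := 𝓘(ℝ, EG)) (I' := 𝓘(ℝ, E)) (n := ∞) (G := G) (M := M)).comp
    (contMDiff_id.prodMk contMDiff_const)

theorem contMDiff_smul_left [MulAction G M] [ContMDiffSMul 𝓘(ℝ, EG) 𝓘(ℝ, E) ∞ G M] (g : G) :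
    ContMDiff 𝓘(ℝ, E) 𝓘(ℝ, E) ∞ (fun x : M ↦ g • x) :=
  (contMDiff_smul (I := 𝓘(ℝ, EG)) (I' := 𝓘(ℝ, E)) (n := ∞) (G := G) (M := M)).comp
    (contMDiff_const.prodMk contMDiff_id)

/-- The orbit maps of a smooth free action are immersive at the identity. -/
theorem injective_mfderiv_orbitMap [LieGroup 𝓘(ℝ, EG) ∞ G] [MulAction G M]
    [ContMDiffSMul 𝓘(ℝ, EG) 𝓘(ℝ, E) ∞ G M]
    (hfree : ∀ (g : G) (p : M), g • p = p → g = 1) (p : M) :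
    Function.Injective (mfderiv 𝓘(ℝ, EG) 𝓘(ℝ, E) (fun g : G ↦ g • p) 1) := by
  have : CompleteSpace EG := FiniteDimensional.complete ℝ EG
  have hO := contMDiff_orbitMap (E := E) (G := G) (EG := EG) p
  have hL : ∀ g : G, ContMDiff 𝓘(ℝ, EG) 𝓘(ℝ, EG) ∞ (fun h : G ↦ g * h) := fun g ↦
    contMDiff_mul_left
  have hS : ∀ g : G, ContMDiff 𝓘(ℝ, E) 𝓘(ℝ, E) ∞ (fun x : M ↦ g • x) :=
    contMDiff_smul_left (EG := EG)
  rw [injective_iff_map_eq_zero]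
  intro ξ hξ
  have : LieGroup 𝓘(ℝ, EG) (minSmoothness ℝ 3) G := by
    rw [minSmoothness_of_isRCLikeNormedField]
    infer_instance
  have hX : ContMDiffAt 𝓘(ℝ, EG) 𝓘(ℝ, EG).tangent 1
      (fun g : G ↦ (⟨g, mulInvariantVectorField ξ g⟩ : TangentBundle 𝓘(ℝ, EG) G)) 1 :=
    (contMDiffAt_mulInvariantVectorField ξ).of_le (by
      rw [minSmoothness_of_isRCLikeNormedField]; norm_num)
  obtain ⟨γ, hγ₀, hγ⟩ := exists_isMIntegralCurveAt_of_contMDiffAt_boundaryless 0 hX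
  -- The identity (g h) • p = g • (h • p) carries the vanishing on ξ at 1 to every point of the
  -- left-invariant field of ξ.
  have hzero : ∀ g : G, mfderiv 𝓘(ℝ, EG) 𝓘(ℝ, E) (fun g : G ↦ g • p) g
      (mulInvariantVectorField ξ g) = 0 := fun g ↦ by
    have h₁ := mfderiv_comp (1 : G) (hO.mdifferentiable (by simp) (g * 1))
      ((hL g).mdifferentiable (by simp) 1)
    have h₂ := mfderiv_comp (1 : G) ((hS g).mdifferentiable (by simp) ((1 : G) • p))
      (hO.mdifferentiable (by simp) 1)
    have h₃ : (fun g : G ↦ g • p) ∘ (fun h : G ↦ g * h) =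
        (fun x : M ↦ g • x) ∘ (fun g : G ↦ g • p) := funext fun h ↦ mul_smul g h p
    have h₄ : ∀ f f' : G → M, f = f' → ∀ v : EG, (mfderiv 𝓘(ℝ, EG) 𝓘(ℝ, E) f 1 v : E) =
        mfderiv 𝓘(ℝ, EG) 𝓘(ℝ, E) f' 1 v := by
      rintro f _ rfl v
      rfl
    have h₅ : ∀ g' : G, g' = g → ∀ v : EG,
        (mfderiv 𝓘(ℝ, EG) 𝓘(ℝ, E) (fun g : G ↦ g • p) g' v : E) =
          mfderiv 𝓘(ℝ, EG) 𝓘(ℝ, E) (fun g : G ↦ g • p) g v := by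
      rintro _ rfl v
      rfl
    refine (h₅ _ (mul_one g) _).symm.trans ?_
    refine (DFunLike.congr_fun h₁ ξ).symm.trans ((h₄ _ _ h₃ ξ).trans ?_)
    refine (DFunLike.congr_fun h₂ ξ).trans ?_
    refine (congrArg (mfderiv 𝓘(ℝ, E) 𝓘(ℝ, E) (fun x : M ↦ g • x) ((1 : G) • p)) hξ).trans ?_
    exact map_zero _
  have hc : ∀ᶠ t in 𝓝 (0 : ℝ), HasMFDerivAt 𝓘(ℝ, ℝ) 𝓘(ℝ, E) (fun t ↦ γ t • p) t 0 := by
    filter_upwards [hγ] with t ht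
    have h₁ := ((hO.mdifferentiable (by simp) (γ t)).hasMFDerivAt).comp t ht
    let D : EG →L[ℝ] E := mfderiv 𝓘(ℝ, EG) 𝓘(ℝ, E) (fun g : G ↦ g • p) (γ t)
    let v : EG := mulInvariantVectorField ξ (γ t)
    have hD : D v = 0 := hzero (γ t)
    have h₂ : D.comp ((1 : ℝ →L[ℝ] ℝ).smulRight v) = 0 := by
      ext
      simp [hD]
    have h₃ : ∀ A : ℝ →L[ℝ] E, A = 0 → HasMFDerivAt 𝓘(ℝ, ℝ) 𝓘(ℝ, E) (fun t ↦ γ t • p) t A →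
        HasMFDerivAt 𝓘(ℝ, ℝ) 𝓘(ℝ, E) (fun t ↦ γ t • p) t 0 := by
      rintro _ rfl h
      exact h
    exact h₃ _ h₂ h₁
  -- γ(t) • p has zero velocity, hence is locally constant; freeness then makes γ itself constant,
  -- which forces its velocity ξ to vanish.
  have hconst : ∀ᶠ t in 𝓝 (0 : ℝ), γ t = 1 := by
    filter_upwards [eventually_eq_of_hasMFDerivAt_zero hc] with t ht
    rw [hγ₀, one_smul] at ht
    exact hfree _ _ ht
  have h₁ := hγ.hasMFDerivAt
  have h₂ : HasMFDerivAt 𝓘(ℝ, ℝ) 𝓘(ℝ, EG) γ 0 (0 : ℝ →L[ℝ] EG) :=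
    (hasMFDerivAt_const (1 : G) (0 : ℝ)).congr_of_eventuallyEq hconst
  have h₃ := DFunLike.congr_fun (hasMFDerivAt_unique h₁ h₂) (1 : ℝ)
  have h₄ : ∀ g : G, g = 1 → (mulInvariantVectorField ξ g : EG) = ξ := by
    rintro _ rfl
    have h₅ : (fun h : G ↦ 1 * h) = id := funext one_mul
    have h₆ : ∀ f : G → G, f = id → (mfderiv 𝓘(ℝ, EG) 𝓘(ℝ, EG) f 1 ξ : EG) = ξ := by
      rintro _ rfl
      rw [mfderiv_id]
      rfl
    exact h₆ _ h₅
  have h₇ : ((1 : ℝ) • (mulInvariantVectorField ξ (γ 0) : EG)) = 0 := h₃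
  rw [one_smul, h₄ _ hγ₀] at h₇
  exact h₇

end OrbitMap

/-- An injective linear map is the restriction of an isomorphism from a direct sum. -/
theorem ContinuousLinearMap.exists_prod_equiv_of_injective {E F K : Type*}
    [NormedAddCommGroup E] [NormedSpace ℝ E] [FiniteDimensional ℝ E]
    [NormedAddCommGroup F] [NormedSpace ℝ F] [FiniteDimensional ℝ F]
    [NormedAddCommGroup K] [NormedSpace ℝ K] [FiniteDimensional ℝ K]
    {D : K →L[ℝ] E} (hD : Function.Injective D)
    (hF : Module.finrank ℝ F = Module.finrank ℝ E - Module.finrank ℝ K) :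
    ∃ A : (F × K) ≃L[ℝ] E, ∀ v, A (0, v) = D v := by
  obtain ⟨W, hW⟩ := Submodule.exists_isCompl (LinearMap.range D.toLinearMap)
  let e₁ := LinearEquiv.ofInjective D.toLinearMap hD
  -- Injectivity of `D` bounds dim K by dim E, so the truncated subtraction in `hF` is exact.
  have h₁ : Module.finrank ℝ F = Module.finrank ℝ W := by
    have h₂ := Submodule.finrank_add_eq_of_isCompl hW
    rw [← e₁.finrank_eq] at h₂
    omega
  let e₂ := LinearEquiv.ofFinrankEq F W h₁
  let A := (e₂.prodCongr e₁).trans (Submodule.prodEquivOfIsCompl W _ hW.symm)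
  refine ⟨A.toContinuousLinearEquiv, fun v ↦ ?_⟩
  change ((e₂ 0 : W) : E) + (e₁ v : E) = D v
  simp [e₁]

/-! ### Slices and the smooth structure on the orbit space. -/

namespace PolyPoisson

section Slice

variable {E : Type*} [NormedAddCommGroup E] [NormedSpace ℝ E] [FiniteDimensional ℝ E]
  {M : Type*} [TopologicalSpace M] [ChartedSpace E M] [IsManifold 𝓘(ℝ, E) ∞ M]
  {EG : Type*} [NormedAddCommGroup EG] [NormedSpace ℝ EG] [FiniteDimensional ℝ EG]
  {G : Type*} [TopologicalSpace G] [ChartedSpace EG G] [Group G] [LieGroup 𝓘(ℝ, EG) ∞ G]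
  [MulAction G M] [ContMDiffSMul 𝓘(ℝ, EG) 𝓘(ℝ, E) ∞ G M]
  {F : Type*} [NormedAddCommGroup F] [NormedSpace ℝ F] [FiniteDimensional ℝ F]

/-- Coordinates near `p` in which the action of group elements close to the identity on a slice
transverse to the orbit of `p` is a local diffeomorphism. -/
theorem exists_slice (hfree : ∀ (g : G) (p : M), g • p = p → g = 1)
    (hF : Module.finrank ℝ F = Module.finrank ℝ E - Module.finrank ℝ EG) (p : M) :
    ∃ (Θ : OpenPartialHomeomorph (F × EG) E) (σ : F → M) (φ : OpenPartialHomeomorph M E)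
      (ϕ : OpenPartialHomeomorph G EG) (_ : (F × EG) ≃L[ℝ] E),
      φ ∈ IsManifold.maximalAtlas 𝓘(ℝ, E) ∞ M ∧ p ∈ φ.source ∧ 1 ∈ ϕ.source ∧
      σ 0 = p ∧ ContinuousAt σ 0 ∧ (0, ϕ 1) ∈ Θ.source ∧
      ContDiffOn ℝ ∞ Θ Θ.source ∧ ContDiffOn ℝ ∞ Θ.symm Θ.target ∧
      ∀ y ∈ Θ.source, y.2 ∈ ϕ.target ∧ ϕ.symm y.2 • σ y.1 ∈ φ.source ∧
        Θ y = φ (ϕ.symm y.2 • σ y.1) := by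
  have : CompleteSpace (F × EG) := FiniteDimensional.complete ℝ _
  let φ := chartAt E ((1 : G) • p)
  let ϕ := chartAt EG (1 : G)
  have hφ : φ ∈ IsManifold.maximalAtlas 𝓘(ℝ, E) ∞ M := IsManifold.chart_mem_maximalAtlas _
  have hϕ : ϕ ∈ IsManifold.maximalAtlas 𝓘(ℝ, EG) ∞ G := by
    have : IsManifold 𝓘(ℝ, EG) ∞ G := ContMDiffMul.toIsManifold
    exact IsManifold.chart_mem_maximalAtlas _
  have hp : p ∈ φ.source := by simp [φ]
  have h1 : 1 ∈ ϕ.source := mem_chart_source EG (1 : G)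
  let D : EG →L[ℝ] E := mfderiv 𝓘(ℝ, EG) 𝓘(ℝ, E) (fun g : G ↦ g • p) 1
  have hD : Function.Injective D := injective_mfderiv_orbitMap hfree p
  obtain ⟨A, hA⟩ := ContinuousLinearMap.exists_prod_equiv_of_injective hD hF
  -- In the chart the slice is affine, in a direction complementary to the tangent space of the
  -- orbit, which is A(0, ·).
  let j : F → E := fun w ↦ φ p + A (w, 0)
  let σ : F → M := fun w ↦ φ.symm (j w)
  have hj : ContDiff ℝ ∞ j :=
    contDiff_const.add (A.contDiff.comp (contDiff_id.prodMk contDiff_const))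
  have hj0 : j 0 = φ p := by
    change φ p + A 0 = φ p
    rw [map_zero, add_zero]
  have hσ0 : σ 0 = p := by
    change φ.symm (j 0) = p
    rw [hj0, φ.left_inv hp]
  have hσ : ContMDiffOn 𝓘(ℝ, F) 𝓘(ℝ, E) ∞ σ (j ⁻¹' φ.target) :=
    (contMDiffOn_symm_of_mem_maximalAtlas hφ).comp hj.contMDiff.contMDiffOn fun w hw ↦ hw
  have hjo : IsOpen (j ⁻¹' φ.target) := φ.open_target.preimage hj.continuous
  have h0 : (0 : F) ∈ j ⁻¹' φ.target := by
    rw [Set.mem_preimage, hj0]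
    exact φ.map_source hp
  let Ψ : F × EG → M := fun y ↦ ϕ.symm y.2 • σ y.1
  let s₁ : Set (F × EG) := (j ⁻¹' φ.target) ×ˢ ϕ.target
  have hs₁ : IsOpen s₁ := hjo.prod ϕ.open_target
  have hΨ : ContMDiffOn 𝓘(ℝ, F × EG) 𝓘(ℝ, E) ∞ Ψ s₁ :=
    (contMDiff_smul (I := 𝓘(ℝ, EG)) (I' := 𝓘(ℝ, E)) (n := ∞) (G := G) (M := M)).comp_contMDiffOn
      (((contMDiffOn_symm_of_mem_maximalAtlas hϕ).comp contDiff_snd.contMDiff.contMDiffOn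
        fun y hy ↦ hy.2).prodMk
        (hσ.comp contDiff_fst.contMDiff.contMDiffOn fun y hy ↦ hy.1))
  let s : Set (F × EG) := s₁ ∩ Ψ ⁻¹' φ.source
  have hs : IsOpen s := hΨ.continuousOn.isOpen_inter_preimage hs₁ φ.open_source
  let a : F × EG := (0, ϕ 1)
  have hΨa : Ψ a = p := by
    change ϕ.symm (ϕ 1) • σ 0 = p
    rw [ϕ.left_inv h1, hσ0, one_smul]
  have ha : a ∈ s := ⟨⟨h0, ϕ.map_source h1⟩, by rwa [Set.mem_preimage, hΨa]⟩
  have hf : ContDiffOn ℝ ∞ (φ ∘ Ψ) s := by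
    rw [← contMDiffOn_iff_contDiffOn]
    exact (contMDiffOn_of_mem_maximalAtlas hφ).comp (hΨ.mono Set.inter_subset_left)
      fun y hy ↦ hy.2
  have hfa : HasFDerivAt (φ ∘ Ψ) (fderiv ℝ (φ ∘ Ψ) a) a :=
    ((hf.contDiffAt (hs.mem_nhds ha)).differentiableAt (by simp)).hasFDerivAt
  -- Along the slice the group element is 1 and the map is `j`, with derivative A(·, 0). Along the
  -- group the slice point is p, and the derivative is that of the orbit map, A(0, ·).
  have hf' : fderiv ℝ (φ ∘ Ψ) a = A := by
    apply ContinuousLinearMap.prod_ext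
    · have h₁ : HasFDerivAt (fun w : F ↦ (w, ϕ 1)) (ContinuousLinearMap.inl ℝ F EG) 0 :=
        hasFDerivAt_prodMk_left 0 (ϕ 1)
      have h₂ := HasFDerivAt.comp (0 : F) (f := fun w : F ↦ (w, ϕ 1)) hfa h₁
      have h₃ : HasFDerivAt j ((A : F × EG →L[ℝ] E).comp (ContinuousLinearMap.inl ℝ F EG)) 0 :=
        (((A : F × EG →L[ℝ] E).comp (ContinuousLinearMap.inl ℝ F EG)).hasFDerivAt).const_add (φ p)
      refine h₂.unique (h₃.congr_of_eventuallyEq ?_)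
      filter_upwards [hjo.mem_nhds h0] with w hw
      change φ (ϕ.symm (ϕ 1) • φ.symm (j w)) = j w
      rw [ϕ.left_inv h1, one_smul, φ.right_inv hw]
    · have h₁ : HasFDerivAt (fun u : EG ↦ ((0 : F), u)) (ContinuousLinearMap.inr ℝ F EG) (ϕ 1) :=
        hasFDerivAt_prodMk_right 0 (ϕ 1)
      have h₂ := HasFDerivAt.comp (ϕ 1) (f := fun u : EG ↦ ((0 : F), u)) hfa h₁
      have hO := contMDiff_orbitMap (E := E) (G := G) (EG := EG) p
      have h₃ := fderiv_writtenInExtChartAt_self (hO.contMDiffAt (x := 1))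
      have h₄ : writtenInExtChartAt 𝓘(ℝ, EG) 𝓘(ℝ, E) 1 (fun g : G ↦ g • p) =
          (φ ∘ Ψ) ∘ fun u : EG ↦ ((0 : F), u) := by
        funext u
        change φ (ϕ.symm u • p) = φ (ϕ.symm u • σ 0)
        rw [hσ0]
      have h₅ : extChartAt 𝓘(ℝ, EG) (1 : G) 1 = ϕ 1 := rfl
      rw [h₄, h₅, h₂.fderiv] at h₃
      ext1 v
      exact (DFunLike.congr_fun h₃ v).symm.trans (hA v).symm
  rw [hf'] at hfa
  obtain ⟨Θ, haΘ, hΘs, hΘ, hΘsymm⟩ := hf.exists_openPartialHomeomorph hs ha hfa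
  refine ⟨Θ, σ, φ, ϕ, A, hφ, hp, h1, hσ0, (hσ.contMDiffAt (hjo.mem_nhds h0)).continuousAt, haΘ,
    ?_, hΘsymm, fun y hy ↦ ⟨(hΘs hy).1.2, (hΘs hy).2, by rw [hΘ]; rfl⟩⟩
  rw [hΘ]
  exact hf.mono hΘs

/-- The chart is Θ⁻¹ ∘ φ, read in `E` through `A`. Equal slice coordinates obviously mean equal
orbits. The converse needs freeness and properness, which keep the group element joining two slice
points near 1, so that injectivity of Θ applies. -/
theorem exists_isAdaptedChart [ProperSMul G M] (hfree : ∀ (g : G) (p : M), g • p = p → g = 1)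
    (hF : Module.finrank ℝ F = Module.finrank ℝ E - Module.finrank ℝ EG) (p : M) :
    ∃ (e : OpenPartialHomeomorph M E) (L : E ≃L[ℝ] F × EG),
      IsAdaptedChart G e L ∧ p ∈ e.source := by
  obtain ⟨Θ, σ, φ, ϕ, A, hφ, hp, h1, hσ0, hσ, hΘ0, hΘ, hΘsymm, hΘσ⟩ := exists_slice hfree hF p
  obtain ⟨B, C, hB, hC, hB0, hC1, hBC⟩ := isOpen_prod_iff.1 Θ.open_source 0 (ϕ 1) hΘ0
  obtain ⟨U, hU, hpU, hUV⟩ := ProperSMul.exists_isOpen_forall_smul_mem hfree p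
    ((ϕ.continuousOn.isOpen_inter_preimage ϕ.open_source hC).mem_nhds ⟨h1, hC1⟩)
  -- `B'` keeps the slice points inside `U`, where properness controls the group element, and the
  -- slice coordinates inside `B`, where B × C lies in the domain of Θ.
  obtain ⟨B', hB'σ, hB', hB'0⟩ := mem_nhds_iff.1 (Filter.inter_mem (hB.mem_nhds hB0)
    (hσ (hU.mem_nhds (by rwa [hσ0]))))
  let Θ' := Θ.restrOpen (B' ×ˢ C) (hB'.prod hC)
  have hsrc : ∀ y ∈ Θ'.source, y ∈ Θ.source ∧ y.1 ∈ B' := fun y hy ↦ ⟨hy.1, hy.2.1⟩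
  have h0' : (0, ϕ 1) ∈ Θ'.source := ⟨hΘ0, hB'0, hC1⟩
  have htgt : Θ'.target ⊆ Θ.target := fun z hz ↦ hz.1
  let e := φ.trans (Θ'.symm.trans A.toHomeomorph.toOpenPartialHomeomorph)
  have hes : ∀ x, x ∈ e.source ↔ x ∈ φ.source ∧ φ x ∈ Θ'.target := fun x ↦ by
    simp [e]
  have hΘp : Θ (0, ϕ 1) = φ p := by
    rw [(hΘσ _ hΘ0).2.2, hσ0, ϕ.left_inv h1, one_smul]
  have he : ∀ x, A.symm (e x) = Θ.symm (φ x) := fun x ↦ A.symm_apply_apply _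
  have hmem : ∀ x ∈ e.source, A.symm (e x) ∈ Θ'.source := fun x hx ↦ by
    rw [he]
    exact Θ'.map_target ((hes x).1 hx).2
  have hx : ∀ x ∈ e.source, ϕ.symm (A.symm (e x)).2 • σ (A.symm (e x)).1 = x := fun x hx ↦ by
    obtain ⟨-, h₁, h₂⟩ := hΘσ _ (hsrc _ (hmem x hx)).1
    refine φ.injOn h₁ ((hes x).1 hx).1 ?_
    rw [← h₂, he]
    exact Θ.right_inv (htgt ((hes x).1 hx).2)
  refine ⟨e, A.symm, ⟨?_, fun x hxe y hye ↦ ?_⟩, (hes p).2 ⟨hp, ?_⟩⟩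
  · rw [IsManifold.mem_maximalAtlas_iff_contMDiffOn]
    constructor
    · refine A.contDiff.contMDiff.comp_contMDiffOn (g := A) (f := fun x ↦ Θ.symm (φ x)) ?_
      refine hΘsymm.contMDiffOn.comp ((contMDiffOn_of_mem_maximalAtlas hφ).mono
        fun x hx ↦ ((hes x).1 hx).1) fun x hx ↦ htgt ((hes x).1 hx).2
    · have ht : ∀ z ∈ e.target, A.symm z ∈ Θ.source ∧ Θ (A.symm z) ∈ φ.target := by
        intro z hz
        have h₁ := (hes _).1 (e.map_target hz)
        have h₂ := hmem _ (e.map_target hz)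
        rw [e.right_inv hz] at h₂
        refine ⟨(hsrc _ h₂).1, ?_⟩
        rw [(hΘσ _ (hsrc _ h₂).1).2.2]
        exact φ.map_source (hΘσ _ (hsrc _ h₂).1).2.1
      refine (contMDiffOn_symm_of_mem_maximalAtlas hφ).comp (f := fun z ↦ Θ (A.symm z)) ?_
        fun z hz ↦ (ht z hz).2
      exact hΘ.contMDiffOn.comp A.symm.contDiff.contMDiff.contMDiffOn fun z hz ↦ (ht z hz).1
  · constructor
    · intro h
      rw [← hx x hxe, ← hx y hye, h, proj_smul, proj_smul]
    · intro h
      rw [← hx x hxe, ← hx y hye, proj_smul, proj_smul] at h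
      have hwx := hB'σ (hsrc _ (hmem x hxe)).2
      have hwy := hB'σ (hsrc _ (hmem y hye)).2
      generalize (A.symm (e x)).1 = w at h hwx ⊢
      generalize (A.symm (e y)).1 = w' at h hwy ⊢
      obtain ⟨k, hk⟩ := proj_eq_iff.1 h
      obtain ⟨hkϕ, hkC⟩ := hUV k (σ w) hwx.2 (by rw [hk]; exact hwy.2)
      have h₁ : (w, ϕ k) ∈ Θ.source := hBC ⟨hwx.1, hkC⟩
      have h₂ : (w', ϕ 1) ∈ Θ.source := hBC ⟨hwy.1, hC1⟩
      -- Both sides are the coordinates of the single point k • σ(w) = σ(w').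
      have h₃ : Θ (w, ϕ k) = Θ (w', ϕ 1) := by
        rw [(hΘσ _ h₁).2.2, (hΘσ _ h₂).2.2, ϕ.left_inv hkϕ, ϕ.left_inv h1, one_smul, hk]
      exact congrArg Prod.fst (Θ.injOn h₁ h₂ h₃)
  · rw [← hΘp]
    exact Θ'.map_source h0'

end Slice

theorem exists_chartedSpace_orbitQuotient
    {E : Type*} [NormedAddCommGroup E] [NormedSpace ℝ E] [FiniteDimensional ℝ E]
    {M : Type*} [TopologicalSpace M] [ChartedSpace E M] [IsManifold 𝓘(ℝ, E) ∞ M]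
    {EG : Type*} [NormedAddCommGroup EG] [NormedSpace ℝ EG] [FiniteDimensional ℝ EG]
    {G : Type*} [TopologicalSpace G] [ChartedSpace EG G] [Group G]
    [LieGroup 𝓘(ℝ, EG) ∞ G]
    [MulAction G M] [ContMDiffSMul 𝓘(ℝ, EG) 𝓘(ℝ, E) ∞ G M] [ProperSMul G M]
    (hfree : ∀ (g : G) (p : M), g • p = p → g = 1)
    {F : Type*} [NormedAddCommGroup F] [NormedSpace ℝ F] [FiniteDimensional ℝ F]
    (hF : Module.finrank ℝ F = Module.finrank ℝ E - Module.finrank ℝ EG) :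
    ∃ (_ : ChartedSpace F (MulAction.orbitRel.Quotient G M)),
      IsManifold 𝓘(ℝ, F) ∞ (MulAction.orbitRel.Quotient G M) ∧
      Manifold.IsSubmersion 𝓘(ℝ, E) 𝓘(ℝ, F) ∞ (proj (M := M) G) := by
  have hΦ := contMDiff_smul_left (E := E) (M := M) (EG := EG) (G := G)
  have : ContinuousConstSMul G M := ⟨fun g ↦ (hΦ g).continuous⟩
  rcases isEmpty_or_nonempty M with hM | hM
  -- For empty `M` the subtraction in `hF` may truncate, but no charts have to be built.
  · have : IsEmpty (MulAction.orbitRel.Quotient G M) := Quotient.instIsEmpty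
    let cs : ChartedSpace F (MulAction.orbitRel.Quotient G M) := ChartedSpace.empty F _
    exact ⟨cs, isManifold_of_contDiffOn _ _ _ fun _ _ he ↦ he.elim,
      Manifold.IsSubmersionOfComplement.isSubmersion (F := EG) fun p ↦ isEmptyElim p⟩
  · exact exists_chartedSpace_of_isAdaptedChart (K := EG) hΦ (exists_isAdaptedChart hfree hF)

end PolyPoisson

end

theorem theorem4p1
    {E : Type*} [NormedAddCommGroup E] [NormedSpace ℝ E] [FiniteDimensional ℝ E]
    {M : Type*} [TopologicalSpace M] [T2Space M] [ChartedSpace E M] [IsManifold 𝓘(ℝ, E) ∞ M]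
    {EG : Type*} [NormedAddCommGroup EG] [NormedSpace ℝ EG] [FiniteDimensional ℝ EG]
    {G : Type*} [TopologicalSpace G] [T2Space G] [ChartedSpace EG G] [Group G]
    [LieGroup 𝓘(ℝ, EG) ∞ G]
    [MulAction G M] [ContMDiffSMul 𝓘(ℝ, EG) 𝓘(ℝ, E) ∞ G M] [ProperSMul G M]
    (hfree : ∀ (g : G) (p : M), g • p = p → g = 1)
    {k : ℕ} (Ω : PolyPoisson.PolysymplecticStructure E k M)
    (hinv : PolyPoisson.IsInvariant G Ω)
    {d : ℕ} (hd : d = Module.finrank ℝ E - Module.finrank ℝ EG) :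
    -- `M / G` has a smooth structure for which `π : M → M / G` is a submersion
    (∃ (_ : ChartedSpace (EuclideanSpace ℝ (Fin d)) (MulAction.orbitRel.Quotient G M)),
      IsManifold (𝓡 d) ∞ (MulAction.orbitRel.Quotient G M) ∧
      Manifold.IsSubmersion 𝓘(ℝ, E) (𝓡 d) ∞ (PolyPoisson.proj (M := M) G)) ∧
    -- and for this structure the reduction theorem holds
    ∀ [ChartedSpace (EuclideanSpace ℝ (Fin d)) (MulAction.orbitRel.Quotient G M)]
      [IsManifold (𝓡 d) ∞ (MulAction.orbitRel.Quotient G M)],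
      Manifold.IsSubmersion 𝓘(ℝ, E) (𝓡 d) ∞ (PolyPoisson.proj (M := M) G) →
      PolyPoisson.IsSubbundle (fun p : M ↦
        Ω.image p ⊓ PolyPoisson.annihilator k
          (PolyPoisson.vertical G (EuclideanSpace ℝ (Fin d)) p)) →
      (∀ p : M,
        (PolyPoisson.annihilator k
            (Ω.orthogonal (PolyPoisson.vertical G (EuclideanSpace ℝ (Fin d)) p)) ⊓
          PolyPoisson.annihilator k (PolyPoisson.vertical G (EuclideanSpace ℝ (Fin d)) p) ⊓
          Ω.image p).comap (Ω.flat p) ≤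
        PolyPoisson.vertical G (EuclideanSpace ℝ (Fin d)) p) →
      ∃! P : PolyPoisson.PolyPoissonStructure (EuclideanSpace ℝ (Fin d)) k
          (MulAction.orbitRel.Quotient G M),
        PolyPoisson.IsReduction Ω P ∧ PolyPoisson.IsQuotientBundle Ω P.S := by
  have hΦ : ∀ g : G, ContMDiff 𝓘(ℝ, E) 𝓘(ℝ, E) ∞ (fun x : M ↦ g • x) :=
    contMDiff_smul_left (EG := EG)
  refine ⟨PolyPoisson.exists_chartedSpace_orbitQuotient hfree (by simpa using hd), ?_⟩
  intro _ _ hπ hS hV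
  refine ⟨PolyPoisson.reducedStructure hΦ hπ hinv hS hV,
    ⟨PolyPoisson.isReduction_reducedStructure hΦ hπ hinv hS hV,
      PolyPoisson.isQuotientBundle_reducedSubspace hΦ hπ hinv⟩, fun P hP ↦ ?_⟩
  exact hP.1.unique (PolyPoisson.isReduction_reducedStructure hΦ hπ hinv hS hV)
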